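/- Let $q$ denote a prime power, $\mathbb F_q$ the field with $q$ elements, and $\mathbb F_q^n$ the $n$-dimensional vector space over it. For $0<\delta<1$ let $E\subseteq\mathbb F_q^n$ be the random subset that contains each vector independently with probability $\delta$. Let $\mathcal A$ be one of the following families of subsets of $\mathbb F_q^n$, all of whose members have the same number $a$ of elements. (1) Non-trivial three-term arithmetic progressions ($a=3$): sets $\{x,x+v,x+2v\}$ whose three members are distinct. Asymptotics are as $q+n\to\infty$. (2) Non-trivial parallelograms ($a=4$): sets of four distinct vectors $x_1,x_2,x_3,x_4$ such that, for some permutation $\sigma$, $x_{\sigma(1)}-x_{\sigma(2)}=x_{\sigma(4)}-x_{\sigma(3)}$ and $x_{\sigma(1)}-x_{\sigma(4)}=x_{\sigma(2)}-x_{\sigma(3)}$. Asymptotics are as $q+n\to\infty$. (3) Non-trivial right triangles ($a=3$): sets of three distinct vectors $x_1,x_2,x_3$ such that, for some permutation $\sigma$, $(x_{\sigma(2)}-x_{\sigma(1)})\cdot(x_{\sigma(3)}-x_{\sigma(1)})=0$, where $\cdot$ is the standard dot product. Asymptotics are as $q\to\infty$, with $n\ge 2$ bounded or growing. (4) $m$-dimensional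 planes ($a=q^m$): translates of $m$-dimensional linear subspaces of $\mathbb F_q^n$, where $1\le m\le n-1$ and $(q,m)\ne(2,1)$. Asymptotics are as $n\to\infty$, with $q$ and $m$ fixed. Let $X$ be the number of members of $\mathcal A$ contained in $E$, so that $\mathbb E(X)=|\mathcal A|\,\delta^a$. Suppose that $|\mathcal A|\,\delta^a\to\lambda$ for some $\lambda\in(0,\infty)$, where $\delta$ may depend on all the parameters. Then $X$ converges in distribution to the Poisson distribution with mean $\lambda$. All limits are taken in the sense stated for the family in question. -/

import Mathlib

open MeasureTheory ProbabilityTheory Filter Topology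
open scoped NNReal

/-- The family of non-trivial three-term arithmetic progressions in `F ^ n`: the sets
`{x, x + v, x + 2v}` whose three members are distinct. -/
def threeAPs (F : Type*) [Field F] (n : ℕ) : Set (Set (Fin n → F)) :=
  {T | ∃ x v : Fin n → F,
    x ≠ x + v ∧ x ≠ x + (2 : F) • v ∧ x + v ≠ x + (2 : F) • v ∧
    T = {x, x + v, x + (2 : F) • v}}

/-- The family of non-trivial parallelograms in `F ^ n`: the sets of four distinct vectors
which, in some order `x₁, x₂, x₃, x₄` (here numbered from `0`), satisfy
`x₁ - x₂ = x₄ - x₃` and `x₁ - x₄ = x₂ - x₃`. -/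
def parallelograms (F : Type*) [Field F] (n : ℕ) : Set (Set (Fin n → F)) :=
  {T | ∃ x : Fin 4 → (Fin n → F), Function.Injective x ∧ T = Set.range x ∧
    ∃ σ : Equiv.Perm (Fin 4),
      x (σ 0) - x (σ 1) = x (σ 3) - x (σ 2) ∧ x (σ 0) - x (σ 3) = x (σ 1) - x (σ 2)}

/-- The family of non-trivial right triangles in `F ^ n`: the sets of three distinct vectors
which, in some order, satisfy `(x₂ - x₁) ⬝ (x₃ - x₁) = 0`. -/
def rightTriangles (F : Type*) [Field F] (n : ℕ) : Set (Set (Fin n → F)) :=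
  {T | ∃ x : Fin 3 → (Fin n → F), Function.Injective x ∧ T = Set.range x ∧
    ∃ σ : Equiv.Perm (Fin 3), (x (σ 1) - x (σ 0)) ⬝ᵥ (x (σ 2) - x (σ 0)) = 0}

/-- The family of `m`-dimensional planes in `F ^ n`: the translates of the `m`-dimensional
linear subspaces. -/
def affinePlanes (F : Type*) [Field F] (n m : ℕ) : Set (Set (Fin n → F)) :=
  {T | ∃ (W : Submodule F (Fin n → F)) (x : Fin n → F),
    Module.finrank F W = m ∧ T = (fun w ↦ x + w) '' (W : Set (Fin n → F))}

/-- The number `X` of members of the family `A` that are contained in `E`. -/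
noncomputable def patternCount {V : Type*} (A : Set (Set V)) (E : Set V) : ℕ :=
  {T ∈ A | T ⊆ E}.ncard

/-- The quantity `|A| δ ^ a`, that is, the expected number of members of the family `A` (each
consisting of `a` vectors) contained in a random set that contains each vector independently
with probability `δ`. -/
noncomputable def expectedCount {V : Type*} (A : Set (Set V)) (a : ℕ) (δ : unitInterval) : ℝ :=
  (A.ncard : ℝ) * (δ : ℝ) ^ a

/-- Along the filter `l`, the number of members of `A i` contained in the random subset of `V i`
that contains each element independently with probability `δ i` converges in distribution, as a
real random variable, to the Poisson distribution with mean `lam`. -/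
def CountTendstoPoisson {ι : Type*} (l : Filter ι) {V : ι → Type*}
    (A : ∀ i, Set (Set (V i))) (δ : ι → unitInterval) (lam : ℝ≥0) : Prop :=
  TendstoInDistribution (fun i (E : Set (V i)) ↦ (patternCount (A i) E : ℝ)) l
    (fun k : ℕ ↦ (k : ℝ)) (fun i ↦ setBernoulli (Set.univ : Set (V i)) (δ i))
    (poissonMeasure lam)

/-! The characteristic function `ψ` of the count `X` almost satisfies the equation that
characterises the Poisson law. Differentiating gives `ψ' t = I * ∑ T, 𝔼[1_{T ⊆ E} exp(itX)]`.
Members disjoint from `T` are independent of `T ⊆ E`, and on that event `T` itself contributes 1.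
So, up to members overlapping `T`, each term is `δ ^ a * exp(it) * ψ t`, and `ψ' ≈ I * L * exp(it) *
ψ` with `L = |𝒜| δ ^ a`. An integrating factor bounds the distance from `ψ t` to `exp (L (exp(it) -
1))` by the total error (`norm_integral_exp_countIn_sub_le`), and Lévy's continuity theorem
concludes once `overlapSum` and `δ ^ a` vanish.

What remains is counting. Grouping overlapping pairs by their intersection `S`, and using `δ ^ a ≈
lam / |𝒜|`, it suffices that for each `S` the number `M` of `T'` with `T ∩ T' = S` satisfies `M ^ a
* r ≤ C * |𝒜| ^ (a - |S|)` for some `r → ∞` (`countTendstoPoisson_of_ncard_inter_le`). Progressions,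
parallelograms and right triangles are solution sets of one equation in `a` points, treated together
in `countTendstoPoisson_range_image`. For planes the condition becomes the exponent inequality
`succ_mul_pow_lt_succ_mul_pow`, which is where `(q, m) = (2, 1)` drops out. -/

/-! ### Independence and the conditional error for a single member. -/

section CharFunBound

variable {V : Type*} [Finite V]

/-- Independence of one coordinate from a function that ignores it, obtained by pairing each `E`
containing `v` with `E \ {v}`. -/
lemma integral_setBernoulli_ite_mem {𝕜 : Type*} [RCLike 𝕜] {δ : unitInterval} (hδ : δ < 1)
    (v : V) (f : Set V → 𝕜) (hf : ∀ E, f (insert v E) = f E) [∀ E : Set V, Decidable (v ∈ E)] :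
    ∫ E, (if v ∈ E then f E else 0) ∂(setBernoulli Set.univ δ) =
      (δ : ℝ) * ∫ E, f E ∂(setBernoulli Set.univ δ) := by
  classical
  have := Fintype.ofFinite V
  have hδ' : (1 : 𝕜) - ((δ : ℝ) : 𝕜) ≠ 0 := by
    have h : (1 : ℝ) - δ ≠ 0 := sub_ne_zero.2 (ne_of_gt (by exact_mod_cast hδ))
    exact_mod_cast h
  set w : Set V → ℝ := fun E ↦ (setBernoulli Set.univ δ).real {E}
  have hw (E : Set V) : w E = (δ : ℝ) ^ E.ncard * (1 - δ) ^ (Eᶜ).ncard := by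
    simp [w, Set.compl_eq_univ_sdiff]
  have hstep (E : Set V) (hE : v ∈ E) : w E * (1 - δ) = δ * w (E \ {v}) := by
    have h1 : E.ncard = (E \ {v}).ncard + 1 := (Set.ncard_sdiff_singleton_add_one hE).symm
    have h2 : (E \ {v})ᶜ = insert v Eᶜ := by
      ext x
      by_cases hx : x = v <;> simp [hx]
    have h3 : ((E \ {v})ᶜ).ncard = (Eᶜ).ncard + 1 := by
      rw [h2, Set.ncard_insert_of_notMem (by simpa using hE)]
    rw [hw, hw, h1, h3]
    ring
  rw [integral_fintype .of_finite, integral_fintype .of_finite]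
  have hA : ∑ E : Set V, w E • (if v ∈ E then f E else 0)
      = ∑ E with v ∈ E, w E • f E := by
    rw [Finset.sum_filter]
    exact Finset.sum_congr rfl fun E _ ↦ by split_ifs <;> simp
  have hAB : (∑ E with v ∈ E, w E • f E) * (1 - ((δ : ℝ) : 𝕜))
      = ((δ : ℝ) : 𝕜) * ∑ E with v ∉ E, w E • f E := by
    rw [Finset.sum_mul, Finset.mul_sum]
    refine Finset.sum_nbij' (fun E ↦ E \ {v}) (fun E ↦ insert v E) ?_ ?_ ?_ ?_ ?_
    · simp
    · simp
    · intro E hE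
      simpa using hE
    · intro E hE
      simpa using hE
    · intro E hE
      have hE' : v ∈ E := by simpa using hE
      have h1 : f (E \ {v}) = f E := by
        rw [← hf, Set.insert_sdiff_singleton, Set.insert_eq_of_mem hE']
      rw [h1, RCLike.real_smul_eq_coe_mul, RCLike.real_smul_eq_coe_mul]
      have h2 : (w E : 𝕜) * (1 - ((δ : ℝ) : 𝕜)) = ((δ : ℝ) : 𝕜) * (w (E \ {v}) : 𝕜) := by
        exact_mod_cast congrArg (fun x : ℝ ↦ (x : 𝕜)) (hstep E hE')
      linear_combination f E * h2
  change ∑ E : Set V, w E • (if v ∈ E then f E else 0) = _ * ∑ E : Set V, w E • f E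
  rw [hA, ← Finset.sum_filter_add_sum_filter_not Finset.univ (fun E : Set V ↦ v ∈ E)]
  linear_combination hAB

lemma integral_setBernoulli_ite_subset {𝕜 : Type*} [RCLike 𝕜] {δ : unitInterval} (hδ : δ < 1)
    (T : Set V) (f : Set V → 𝕜) (hf : ∀ v ∈ T, ∀ E, f (insert v E) = f E)
    [∀ S E : Set V, Decidable (S ⊆ E)] :
    ∫ E, (if T ⊆ E then f E else 0) ∂(setBernoulli Set.univ δ) =
      ((δ : ℝ) : 𝕜) ^ T.ncard * ∫ E, f E ∂(setBernoulli Set.univ δ) := by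
  classical
  induction T, T.toFinite using Set.Finite.induction_on with
  | empty => simp
  | @insert v T hv hT ih =>
    have h1 := ih (fun u hu ↦ hf u (Set.mem_insert_of_mem _ hu))
    have h2 := integral_setBernoulli_ite_mem hδ v (fun E ↦ if T ⊆ E then f E else 0)
      (fun E ↦ by
        simp [Set.subset_insert_iff_of_notMem hv, hf v (Set.mem_insert _ _)])
    rw [Set.ncard_insert_of_notMem hv, pow_succ', mul_assoc, ← h1, ← h2]
    congr 1 with E
    by_cases h : v ∈ E <;> simp [Set.insert_subset_iff, h]

lemma integral_setBernoulli_indicator_subset {δ : unitInterval} (hδ : δ < 1) (T : Set V)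
    [∀ S E : Set V, Decidable (S ⊆ E)] :
    ∫ E, (if T ⊆ E then (1 : ℝ) else 0) ∂(setBernoulli Set.univ δ) = (δ : ℝ) ^ T.ncard := by
  simpa using integral_setBernoulli_ite_subset (𝕜 := ℝ) hδ T (fun _ ↦ 1) (fun _ _ _ ↦ rfl)

/-- The number of members of a finite family that are contained in `E`. -/
noncomputable def countIn (𝒜 : Finset (Set V)) (E : Set V) : ℕ := by
  classical exact (𝒜.filter (· ⊆ E)).card

omit [Finite V] in
lemma patternCount_coe (𝒜 : Finset (Set V)) (E : Set V) :
    patternCount (𝒜 : Set (Set V)) E = countIn 𝒜 E := by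
  classical
  rw [patternCount, countIn, ← Set.ncard_coe_finset]
  congr 1
  ext T
  simp

omit [Finite V] in
lemma countIn_eq_sum (𝒜 : Finset (Set V)) (E : Set V) [∀ S E : Set V, Decidable (S ⊆ E)] :
    countIn 𝒜 E = ∑ T ∈ 𝒜, if T ⊆ E then 1 else 0 := by
  rw [countIn, Finset.card_filter]
  exact Finset.sum_congr rfl fun T _ ↦ by split_ifs <;> rfl

omit [Finite V] in
lemma countIn_filter_add_filter_not (𝒜 : Finset (Set V)) (p : Set V → Prop) [DecidablePred p]
    (E : Set V) : countIn (𝒜.filter p) E + countIn (𝒜.filter (¬ p ·)) E = countIn 𝒜 E := by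
  classical
  simp only [countIn_eq_sum]
  exact Finset.sum_filter_add_sum_filter_not _ _ _

/-- Points of the unit circle are at distance at most 2, and `k ≥ 1` unless they coincide. The bound
is free of `t`, so the error in the differential equation is uniform. -/
lemma norm_exp_natCast_add_sub_le (t : ℝ) (m k : ℕ) :
    ‖Complex.exp (t * (m + k : ℕ) * Complex.I) - Complex.exp (t * m * Complex.I)‖ ≤ 2 * k := by
  rcases Nat.eq_zero_or_pos k with rfl | hk
  · simp
  have h (x : ℝ) : ‖Complex.exp (x * Complex.I)‖ = 1 := Complex.norm_exp_ofReal_mul_I x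
  have h1 := h (t * (m + k : ℕ))
  have h2 := h (t * m)
  push_cast at h1 h2 ⊢
  have hk' : (1 : ℝ) ≤ k := by exact_mod_cast hk
  exact (norm_sub_le _ _).trans (by rw [h1, h2]; linarith)

lemma integral_countIn {δ : unitInterval} (hδ : δ < 1) (𝒜 : Finset (Set V)) :
    ∫ E, (countIn 𝒜 E : ℝ) ∂(setBernoulli Set.univ δ) = ∑ T ∈ 𝒜, (δ : ℝ) ^ T.ncard := by
  classical
  simp only [countIn_eq_sum, Nat.cast_sum, Nat.cast_ite, Nat.cast_one, Nat.cast_zero]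
  rw [integral_finsetSum _ fun _ _ ↦ .of_finite]
  exact Finset.sum_congr rfl fun T _ ↦ integral_setBernoulli_indicator_subset hδ T

/-- The first error comes from dropping the other members that meet `T` while `T ⊆ E`; the second
from restoring all members meeting `T` after `T ⊆ E` has been factored out. -/
lemma norm_integral_ite_exp_sub_le {δ : unitInterval} (hδ : δ < 1) (𝒜 : Finset (Set V))
    {T : Set V} (hT : T ∈ 𝒜) (hT0 : T.Nonempty) (t : ℝ) [∀ S E : Set V, Decidable (S ⊆ E)]
    [DecidablePred fun T' : Set V ↦ Disjoint T T'] [DecidableEq (Set V)] :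
    ‖∫ E, (if T ⊆ E then Complex.exp (t * countIn 𝒜 E * Complex.I) else 0)
          ∂(setBernoulli Set.univ δ)
        - Complex.exp (t * Complex.I) * (((δ : ℝ) : ℂ) ^ T.ncard
          * ∫ E, Complex.exp (t * countIn 𝒜 E * Complex.I) ∂(setBernoulli Set.univ δ))‖ ≤
      2 * (∑ T' ∈ (𝒜.filter (¬ Disjoint T ·)).erase T, (δ : ℝ) ^ (T ∪ T').ncard)
        + 2 * ((δ : ℝ) ^ T.ncard * ∑ T' ∈ 𝒜.filter (¬ Disjoint T ·), (δ : ℝ) ^ T'.ncard) := by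
  classical
  set μ := setBernoulli (Set.univ : Set V) δ
  set near := 𝒜.filter (¬ Disjoint T ·)
  set far := 𝒜.filter (Disjoint T ·)
  have hcnt (E : Set V) : countIn far E + countIn near E = countIn 𝒜 E :=
    countIn_filter_add_filter_not 𝒜 _ E
  have hTnear : T ∈ near := by simp [near, hT, hT0.ne_empty]
  have hnear (E : Set V) (hE : T ⊆ E) : countIn near E = 1 + countIn (near.erase T) E := by
    rw [countIn_eq_sum, countIn_eq_sum, ← Finset.add_sum_erase _ _ hTnear, if_pos hE]
  have hδ0 : (0 : ℝ) ≤ δ := δ.2.1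
  -- replace the count by the far count, up to the contribution of `T`
  have h1 : ‖∫ E, (if T ⊆ E then Complex.exp (t * countIn 𝒜 E * Complex.I) else 0) ∂μ
      - ∫ E, (if T ⊆ E then Complex.exp (t * Complex.I)
          * Complex.exp (t * countIn far E * Complex.I) else 0) ∂μ‖
      ≤ 2 * ∑ T' ∈ near.erase T, (δ : ℝ) ^ (T ∪ T').ncard := by
    rw [← integral_sub .of_finite .of_finite]
    calc _ ≤ ∫ E, 2 * ∑ T' ∈ near.erase T, (if T ∪ T' ⊆ E then (1 : ℝ) else 0) ∂μ := by
          refine norm_integral_le_of_norm_le .of_finite (.of_forall fun E ↦ ?_)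
          by_cases hE : T ⊆ E
          · simp only [hE, if_true]
            have h := norm_exp_natCast_add_sub_le t (1 + countIn far E)
              (countIn (near.erase T) E)
            have e1 : 1 + countIn far E + countIn (near.erase T) E = countIn 𝒜 E := by
              rw [← hcnt, hnear E hE]; ring
            have e2 : Complex.exp (t * (1 + countIn far E : ℕ) * Complex.I)
                = Complex.exp (t * Complex.I) * Complex.exp (t * countIn far E * Complex.I) := by
              rw [← Complex.exp_add]
              push_cast
              ring_nf
            rw [e1, e2] at h
            refine h.trans (le_of_eq ?_)
            rw [countIn_eq_sum]
            push_cast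
            simp [Set.union_subset_iff, hE]
          · simp [hE, Set.union_subset_iff]
      _ = _ := by
          rw [integral_const_mul, integral_finsetSum _ fun _ _ ↦ .of_finite]
          congr 1
          exact Finset.sum_congr rfl fun T' _ ↦ integral_setBernoulli_indicator_subset hδ _
  -- This factorisation is exact: adding points of `T` to `E` does not change the far count.
  have h2 : ∫ E, (if T ⊆ E then Complex.exp (t * Complex.I)
          * Complex.exp (t * countIn far E * Complex.I) else 0) ∂μ
      = Complex.exp (t * Complex.I) * (((δ : ℝ) : ℂ) ^ T.ncard
        * ∫ E, Complex.exp (t * countIn far E * Complex.I) ∂μ) := by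
    have h := integral_setBernoulli_ite_subset (𝕜 := ℂ) hδ T
      (fun E ↦ Complex.exp (t * Complex.I) * Complex.exp (t * countIn far E * Complex.I)) ?_
    · refine h.trans ?_
      rw [integral_const_mul]
      simp only [Complex.coe_algebraMap]
      ring
    · intro v hv E
      have : countIn far (insert v E) = countIn far E := by
        rw [countIn_eq_sum, countIn_eq_sum]
        refine Finset.sum_congr rfl fun T' hT' ↦ ?_
        have hd : Disjoint T T' := by simpa [far] using (Finset.mem_filter.1 hT').2
        simp only [Set.subset_insert_iff_of_notMem (Set.disjoint_left.1 hd hv)]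
      rw [this]
  have h3 : ‖∫ E, Complex.exp (t * countIn far E * Complex.I) ∂μ
      - ∫ E, Complex.exp (t * countIn 𝒜 E * Complex.I) ∂μ‖
      ≤ 2 * ∑ T' ∈ near, (δ : ℝ) ^ T'.ncard := by
    rw [← integral_sub .of_finite .of_finite, ← integral_countIn hδ, ← integral_const_mul]
    refine norm_integral_le_of_norm_le .of_finite (.of_forall fun E ↦ ?_)
    rw [norm_sub_rev, ← hcnt]
    exact norm_exp_natCast_add_sub_le t _ _
  rw [h2] at h1
  have hexp : ‖Complex.exp (t * Complex.I)‖ = 1 := Complex.norm_exp_ofReal_mul_I t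
  have h4 : ‖Complex.exp (t * Complex.I) * (((δ : ℝ) : ℂ) ^ T.ncard
        * ∫ E, Complex.exp (t * countIn far E * Complex.I) ∂μ)
      - Complex.exp (t * Complex.I) * (((δ : ℝ) : ℂ) ^ T.ncard
        * ∫ E, Complex.exp (t * countIn 𝒜 E * Complex.I) ∂μ)‖
      ≤ 2 * ((δ : ℝ) ^ T.ncard * ∑ T' ∈ near, (δ : ℝ) ^ T'.ncard) := by
    rw [← mul_sub, ← mul_sub, norm_mul, norm_mul, hexp, one_mul, norm_pow, Complex.norm_real,
      Real.norm_of_nonneg hδ0]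
    calc _ ≤ (δ : ℝ) ^ T.ncard * (2 * ∑ T' ∈ near, (δ : ℝ) ^ T'.ncard) :=
          mul_le_mul_of_nonneg_left h3 (by positivity)
      _ = _ := by ring
  exact (norm_sub_le_norm_sub_add_norm_sub _ _ _).trans (add_le_add h1 h4)

end CharFunBound

/-! ### The approximate differential equation and its solution. -/

section PoissonApproximation

variable {V : Type*}

open scoped Classical in
/-- The expected number of ordered pairs of distinct intersecting members of `𝒜` that are both
contained in a random set containing each element independently with probability `δ`. -/
noncomputable def overlapSum (𝒜 : Finset (Set V)) (δ : ℝ) : ℝ :=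
  ∑ T ∈ 𝒜, ∑ T' ∈ (𝒜.filter (¬ Disjoint T ·)).erase T, δ ^ (T ∪ T').ncard

variable [Finite V]

lemma hasDerivAt_integral_exp_countIn (𝒜 : Finset (Set V)) (δ : unitInterval) (t : ℝ)
    [∀ S E : Set V, Decidable (S ⊆ E)] :
    HasDerivAt (fun s : ℝ ↦ ∫ E, Complex.exp (s * countIn 𝒜 E * Complex.I)
        ∂(setBernoulli Set.univ δ))
      (∑ T ∈ 𝒜, Complex.I * ∫ E, (if T ⊆ E then Complex.exp (t * countIn 𝒜 E * Complex.I) else 0)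
        ∂(setBernoulli Set.univ δ)) t := by
  have := Fintype.ofFinite (Set V)
  simp only [integral_fintype Integrable.of_finite]
  have h (E : Set V) : HasDerivAt
      (fun s : ℝ ↦ (setBernoulli Set.univ δ).real {E}
        • Complex.exp (s * countIn 𝒜 E * Complex.I))
      ((setBernoulli Set.univ δ).real {E}
        • (Complex.exp (t * countIn 𝒜 E * Complex.I) * (countIn 𝒜 E * Complex.I))) t := by
    refine HasDerivAt.const_smul (F := ℂ) (R := ℝ) _ (HasDerivAt.cexp ?_)
    have := ((Complex.ofRealCLM.hasDerivAt (x := t)).mul_const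
      (countIn 𝒜 E : ℂ)).mul_const Complex.I
    simpa using this
  refine (HasDerivAt.fun_sum (u := Finset.univ) fun E _ ↦ h E).congr_deriv (Eq.symm ?_)
  simp_rw [Finset.mul_sum]
  rw [Finset.sum_comm]
  refine Finset.sum_congr rfl fun E _ ↦ ?_
  rw [countIn_eq_sum]
  simp only [Complex.real_smul, Nat.cast_sum, Finset.sum_mul, Finset.mul_sum]
  refine Finset.sum_congr rfl fun T _ ↦ ?_
  split_ifs
  · push_cast
    ring
  · simp

-- Since `|T ∪ T'| ≤ 2a`, the product-type error is dominated by the overlap error; only the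
-- diagonal term `T' = T` is left over.
omit [Finite V] in
lemma sum_overlap_le {δ : ℝ} (hδ : 0 ≤ δ) (hδ1 : δ ≤ 1) {𝒜 : Finset (Set V)} {a : ℕ}
    (ha : ∀ T ∈ 𝒜, T.ncard = a) {T : Set V} (hT : T ∈ 𝒜) (hT0 : T.Nonempty)
    [DecidablePred fun T' : Set V ↦ Disjoint T T'] [DecidableEq (Set V)] :
    δ ^ a * ∑ T' ∈ 𝒜.filter (¬ Disjoint T ·), δ ^ T'.ncard ≤
      (∑ T' ∈ (𝒜.filter (¬ Disjoint T ·)).erase T, δ ^ (T ∪ T').ncard) + δ ^ a * δ ^ a := by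
  have hmem : T ∈ 𝒜.filter (¬ Disjoint T ·) := by simp [hT, hT0.ne_empty]
  rw [← Finset.sum_erase_add _ _ hmem, mul_add, ha T hT, Finset.mul_sum]
  gcongr with T' hT'
  rw [← pow_add]
  refine pow_le_pow_of_le_one hδ hδ1 ?_
  have h := ha T' (Finset.mem_filter.1 (Finset.mem_of_mem_erase hT')).1
  have h' := Set.ncard_union_le T T'
  rw [ha T hT] at h'
  omega

/-- Multiplying `ψ` by `exp (-u)`, where `exp u` solves the exact equation, leaves a function with
small derivative and value 1 at 0. -/
theorem norm_integral_exp_countIn_sub_le {δ : unitInterval} (hδ : δ < 1) (𝒜 : Finset (Set V))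
    {a : ℕ} (ha0 : a ≠ 0) (ha : ∀ T ∈ 𝒜, T.ncard = a) (t : ℝ) :
    ‖∫ E, Complex.exp (t * countIn 𝒜 E * Complex.I) ∂(setBernoulli Set.univ δ)
        - Complex.exp ((𝒜.card * (δ : ℝ) ^ a : ℝ) * (Complex.exp (t * Complex.I) - 1))‖ ≤
      (4 * overlapSum 𝒜 δ + 2 * (𝒜.card * (δ : ℝ) ^ a) * (δ : ℝ) ^ a)
        * Real.exp (2 * (𝒜.card * (δ : ℝ) ^ a)) * |t| := by
  classical
  set μ := setBernoulli (Set.univ : Set V) δ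
  have hδ0 : (0 : ℝ) ≤ δ := δ.2.1
  set L : ℝ := 𝒜.card * (δ : ℝ) ^ a with hL
  have hL0 : 0 ≤ L := by positivity
  set ψ : ℝ → ℂ := fun s ↦ ∫ E, Complex.exp (s * countIn 𝒜 E * Complex.I) ∂μ with hψ
  set ψ' : ℝ → ℂ := fun s ↦ ∑ T ∈ 𝒜, Complex.I *
    ∫ E, (if T ⊆ E then Complex.exp (s * countIn 𝒜 E * Complex.I) else 0) ∂μ with hψ'
  set ε := 4 * overlapSum 𝒜 δ + 2 * L * (δ : ℝ) ^ a with hε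
  have hne (T) (hT : T ∈ 𝒜) : T.Nonempty :=
    Set.nonempty_of_ncard_ne_zero (by rw [ha T hT]; exact ha0)
  have hexp (x : ℝ) : ‖Complex.exp (x * Complex.I)‖ = 1 := Complex.norm_exp_ofReal_mul_I x
  have hode (s : ℝ) : ‖ψ' s - Complex.I * Complex.exp (s * Complex.I) * L * ψ s‖ ≤ ε := by
    have e : ψ' s - Complex.I * Complex.exp (s * Complex.I) * L * ψ s
        = ∑ T ∈ 𝒜, Complex.I * (∫ E, (if T ⊆ E then
            Complex.exp (s * countIn 𝒜 E * Complex.I) else 0) ∂μ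
          - Complex.exp (s * Complex.I) * (((δ : ℝ) : ℂ) ^ T.ncard * ψ s)) := by
      simp only [mul_sub, Finset.sum_sub_distrib, hψ']
      congr 1
      rw [Finset.sum_congr rfl fun T hT ↦ by rw [ha T hT], Finset.sum_const, nsmul_eq_mul, hL]
      push_cast
      ring
    rw [e]
    calc _ ≤ ∑ T ∈ 𝒜, (4 * (∑ T' ∈ (𝒜.filter (¬ Disjoint T ·)).erase T, (δ : ℝ) ^ (T ∪ T').ncard)
              + 2 * ((δ : ℝ) ^ a * (δ : ℝ) ^ a)) := by
          refine norm_sum_le_of_le _ fun T hT ↦ ?_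
          rw [norm_mul, Complex.norm_I, one_mul]
          refine (norm_integral_ite_exp_sub_le hδ 𝒜 hT (hne T hT) s).trans ?_
          have := sum_overlap_le hδ0 δ.2.2 ha hT (hne T hT)
          rw [ha T hT]
          linarith
      _ = ε := by
          rw [Finset.sum_add_distrib, ← Finset.mul_sum, Finset.sum_const, nsmul_eq_mul, hε, hL]
          unfold overlapSum
          ring_nf
  set u : ℝ → ℂ := fun s ↦ L * (Complex.exp (s * Complex.I) - 1) with hu
  have hure (s : ℝ) : (u s).re = L * (Real.cos s - 1) := by
    simp [hu, Complex.exp_ofReal_mul_I_re]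
  -- The real part of `u` lies in `[-2L, 0]`, which is the source of `exp (2L)`.
  have hu1 (s : ℝ) : ‖Complex.exp (u s)‖ ≤ 1 := by
    rw [Complex.norm_exp, hure, Real.exp_le_one_iff]
    nlinarith [Real.cos_le_one s]
  have hu2 (s : ℝ) : ‖Complex.exp (-u s)‖ ≤ Real.exp (2 * L) := by
    rw [Complex.norm_exp, Complex.neg_re, hure, Real.exp_le_exp]
    nlinarith [Real.neg_one_le_cos s]
  have hud (s : ℝ) : HasDerivAt u (L * (Complex.exp (s * Complex.I) * Complex.I)) s := by
    have h1 : HasDerivAt (fun s : ℝ ↦ (s : ℂ) * Complex.I) Complex.I s := by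
      simpa using (Complex.ofRealCLM.hasDerivAt (x := s)).mul_const Complex.I
    simpa using (h1.cexp.sub_const 1).const_mul (L : ℂ)
  have hψd (s : ℝ) : HasDerivAt ψ (ψ' s) s := hasDerivAt_integral_exp_countIn 𝒜 δ s
  have hg (s : ℝ) : HasDerivAt (fun s ↦ ψ s * Complex.exp (-u s))
      ((ψ' s - Complex.I * Complex.exp (s * Complex.I) * L * ψ s) * Complex.exp (-u s)) s := by
    refine ((hψd s).mul (hud s).neg.cexp).congr_deriv ?_
    simp only [Pi.neg_apply]
    ring
  have hψ0 : ψ 0 = 1 := by simp [hψ]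
  have hu0 : u 0 = 0 := by simp [hu]
  have hbound : ‖ψ t * Complex.exp (-u t) - 1‖ ≤ ε * Real.exp (2 * L) * |t| := by
    have h := Convex.norm_image_sub_le_of_norm_hasDerivWithin_le (s := Set.univ) (x := (0 : ℝ))
      (y := t) (C := ε * Real.exp (2 * L)) (fun s _ ↦ (hg s).hasDerivWithinAt)
      (fun s _ ↦ by
        rw [norm_mul]
        exact mul_le_mul (hode s) (hu2 s) (norm_nonneg _) ((norm_nonneg _).trans (hode s)))
      convex_univ (Set.mem_univ _) (Set.mem_univ _)
    simpa [hψ0, hu0] using h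
  have e : ψ t - Complex.exp (u t) = (ψ t * Complex.exp (-u t) - 1) * Complex.exp (u t) := by
    rw [sub_mul, mul_assoc, ← Complex.exp_add]
    simp
  change ‖ψ t - Complex.exp (u t)‖ ≤ _
  rw [e, norm_mul]
  calc _ ≤ ε * Real.exp (2 * L) * |t| * 1 :=
        mul_le_mul hbound (hu1 t) (norm_nonneg _) ((norm_nonneg _).trans hbound)
    _ = _ := mul_one _

end PoissonApproximation

/-! ### Poisson convergence from counts of members with prescribed intersection. -/

section PoissonLimit

theorem countTendstoPoisson_of_tendsto_overlapSum {ι : Type*} {l : Filter ι} {V : ι → Type*}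
    [∀ i, Finite (V i)] (𝒜 : ∀ i, Finset (Set (V i))) {δ : ι → unitInterval}
    (hδ : ∀ i, δ i < 1) {lam : ℝ≥0} {a : ℕ} (ha0 : a ≠ 0) (ha : ∀ i, ∀ T ∈ 𝒜 i, T.ncard = a)
    (hexp : Tendsto (fun i ↦ ((𝒜 i).card : ℝ) * (δ i : ℝ) ^ a) l (𝓝 lam))
    (hover : Tendsto (fun i ↦ overlapSum (𝒜 i) (δ i)) l (𝓝 0))
    (hpow : Tendsto (fun i ↦ (δ i : ℝ) ^ a) l (𝓝 0)) :
    CountTendstoPoisson l (fun i ↦ (𝒜 i : Set (Set (V i)))) δ lam := by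
  -- Lévy's theorem is about sequences: pass to a countably generated filter
  set g : ι → ℝ × ℝ × ℝ := fun i ↦
    (((𝒜 i).card : ℝ) * (δ i : ℝ) ^ a, overlapSum (𝒜 i) (δ i), (δ i : ℝ) ^ a) with hg
  have hl : l ≤ comap g (𝓝 ((lam : ℝ), 0, 0)) :=
    tendsto_iff_comap.1 (hexp.prodMk_nhds (hover.prodMk_nhds hpow))
  refine ⟨fun i ↦ (Measurable.of_discrete).aemeasurable, Measurable.of_discrete.aemeasurable,
    Tendsto.mono_left ?_ hl⟩
  refine tendsto_of_seq_tendsto fun x hx ↦ ?_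
  have hgx : Tendsto (fun k ↦ g (x k)) atTop (𝓝 ((lam : ℝ), 0, 0)) := tendsto_comap_iff.1 hx
  have h1 : Tendsto (fun k ↦ (g (x k)).1) atTop (𝓝 (lam : ℝ)) :=
    (continuous_fst.tendsto _).comp hgx
  have h2 : Tendsto (fun k ↦ (g (x k)).2.1) atTop (𝓝 0) :=
    ((continuous_fst.comp continuous_snd).tendsto _).comp hgx
  have h3 : Tendsto (fun k ↦ (g (x k)).2.2) atTop (𝓝 0) :=
    ((continuous_snd.comp continuous_snd).tendsto _).comp hgx
  refine ProbabilityMeasure.tendsto_of_tendsto_charFun fun t ↦ ?_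
  have hlim : charFun ((poissonMeasure lam).map (fun k : ℕ ↦ (k : ℝ))) t
      = Complex.exp (lam * (Complex.exp (t * Complex.I) - 1)) :=
    charFun_map_cast_poissonMeasure lam t
  have hchar (k : ℕ) : charFun ((setBernoulli Set.univ (δ (x k))).map
      (fun E : Set (V (x k)) ↦ (patternCount (𝒜 (x k) : Set (Set (V (x k)))) E : ℝ))) t
      = ∫ E, Complex.exp (t * countIn (𝒜 (x k)) E * Complex.I)
          ∂(setBernoulli Set.univ (δ (x k))) := by
    rw [charFun_apply_real, integral_map Measurable.of_discrete.aemeasurable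
      (Continuous.aestronglyMeasurable (by fun_prop))]
    simp [patternCount_coe]
  change Tendsto (fun k ↦ charFun ((setBernoulli Set.univ (δ (x k))).map
      (fun E : Set (V (x k)) ↦ (patternCount (𝒜 (x k) : Set (Set (V (x k)))) E : ℝ))) t) atTop
    (𝓝 (charFun ((poissonMeasure lam).map (fun k : ℕ ↦ (k : ℝ))) t))
  rw [hlim]
  simp only [hchar]
  have herr : Tendsto (fun k ↦ (4 * (g (x k)).2.1 + 2 * (g (x k)).1 * (g (x k)).2.2)
      * Real.exp (2 * (g (x k)).1) * |t|) atTop (𝓝 0) := by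
    have h := (((h2.const_mul 4).add ((h1.const_mul 2).mul h3)).mul
      ((Real.continuous_exp.tendsto _).comp (h1.const_mul 2))).mul_const |t|
    simpa using h
  have hmain : Tendsto (fun k ↦ Complex.exp (((g (x k)).1 : ℝ)
      * (Complex.exp (t * Complex.I) - 1))) atTop
      (𝓝 (Complex.exp (lam * (Complex.exp (t * Complex.I) - 1)))) := by
    refine (Complex.continuous_exp.tendsto _).comp (Tendsto.mul_const _ ?_)
    exact (Complex.continuous_ofReal.tendsto _).comp h1
  refine (tendsto_iff_of_dist (squeeze_zero (fun _ ↦ dist_nonneg) (fun k ↦ ?_) herr)).1 hmain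
  rw [dist_comm, dist_eq_norm]
  exact norm_integral_exp_countIn_sub_le (hδ _) (𝒜 (x k)) ha0 (ha _) t

/-- Group the `T'` by `S = T ∩ T'`: then `|T ∪ T'| = 2a - |S|`, and there are `2 ^ a` candidates for
`S`. -/
lemma overlapSum_le {V : Type*} [Finite V] (𝒜 : Finset (Set V)) {δ η : ℝ} (hδ : 0 ≤ δ)
    (hη : 0 ≤ η) {a : ℕ} (ha : ∀ T ∈ 𝒜, T.ncard = a)
    (h : ∀ T ∈ 𝒜, ∀ S ⊂ T, S.Nonempty →
      ({T' ∈ (𝒜 : Set (Set V)) | T ∩ T' = S}.ncard : ℝ) * δ ^ (a - S.ncard) ≤ η) :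
    overlapSum 𝒜 δ ≤ (𝒜.card * δ ^ a) * 2 ^ a * η := by
  classical
  have hT (T) (hT : T ∈ 𝒜) : ∑ T' ∈ (𝒜.filter (¬ Disjoint T ·)).erase T, δ ^ (T ∪ T').ncard
      ≤ 2 ^ a * (δ ^ a * η) := by
    have hfin : (𝒫 T).Finite := T.toFinite.powerset
    have hmaps : ∀ T' ∈ (𝒜.filter (¬ Disjoint T ·)).erase T, T ∩ T' ∈ hfin.toFinset := by
      intro T' _
      simp
    rw [← Finset.sum_fiberwise_of_maps_to hmaps]
    have hcard : hfin.toFinset.card = 2 ^ a := by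
      rw [← Set.ncard_eq_toFinset_card _ hfin, Set.ncard_powerset, ha T hT]
    calc _ ≤ ∑ S ∈ hfin.toFinset, δ ^ a * η := by
          refine Finset.sum_le_sum fun S hS ↦ ?_
          have hST : S ⊆ T := by simpa using hS
          by_cases hgood : S ≠ T ∧ S.Nonempty
          · have hle : S.ncard ≤ a := by rw [← ha T hT]; exact Set.ncard_le_ncard hST
            calc _ = ∑ T' ∈ ((𝒜.filter (¬ Disjoint T ·)).erase T).filter (T ∩ · = S),
                    δ ^ a * δ ^ (a - S.ncard) := by
                  refine Finset.sum_congr rfl fun T' hT' ↦ ?_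
                  simp only [Finset.mem_filter, Finset.mem_erase] at hT'
                  rw [← pow_add]
                  congr 1
                  have h1 := Set.ncard_union_add_ncard_inter T T'
                  rw [hT'.2, ha T hT, ha T' hT'.1.2.1] at h1
                  omega
              _ ≤ δ ^ a * (({T' ∈ (𝒜 : Set (Set V)) | T ∩ T' = S}.ncard : ℝ)
                    * δ ^ (a - S.ncard)) := by
                  rw [Finset.sum_const, nsmul_eq_mul, mul_left_comm]
                  gcongr
                  rw [← Set.ncard_coe_finset]
                  refine Set.ncard_le_ncard fun T' hT' ↦ ?_
                  simp at hT' ⊢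
                  tauto
              _ ≤ _ := by
                  gcongr
                  exact h T hT S (hST.ssubset_of_ne hgood.1) hgood.2
          -- Other fibres are empty: `S = T` would force `T' = T` by equal size, and `S = ∅`
          -- contradicts overlapping.
          · rw [Finset.sum_eq_zero]
            · positivity
            · intro T' hT'
              exfalso
              simp only [Finset.mem_filter, Finset.mem_erase] at hT'
              refine hgood ⟨?_, ?_⟩
              · rintro rfl
                refine hT'.1.1 (Set.eq_of_subset_of_ncard_le (Set.inter_eq_left.1 hT'.2) ?_).symm
                rw [ha _ hT, ha _ hT'.1.2.1]
              · rw [← hT'.2]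
                exact Set.not_disjoint_iff_nonempty_inter.1 hT'.1.2.2
      _ = _ := by rw [Finset.sum_const, hcard, nsmul_eq_mul]; push_cast; ring
  calc overlapSum 𝒜 δ ≤ ∑ T ∈ 𝒜, 2 ^ a * (δ ^ a * η) := by
        unfold overlapSum
        refine Finset.sum_le_sum fun T hT' ↦ ?_
        convert hT T hT'
    _ = _ := by rw [Finset.sum_const, nsmul_eq_mul]; ring

/-- The `a`-th power of `M * δ ^ (a - |S|)` involves `δ` only through `δ ^ a`, which `hΛ` controls.
Assuming `1 ≤ Λ` makes the bound independent of `S`. -/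
lemma overlapSum_le_of_ncard_inter_le {V : Type*} [Finite V] (𝒜 : Finset (Set V))
    {δ Λ C r : ℝ} (hδ : 0 ≤ δ) (hΛ1 : 1 ≤ Λ) (hC : 0 ≤ C) (hr : 0 < r) {a : ℕ} (ha0 : a ≠ 0)
    (ha : ∀ T ∈ 𝒜, T.ncard = a) (hΛ : 𝒜.card * δ ^ a ≤ Λ)
    (h : ∀ T ∈ 𝒜, ∀ S ⊂ T, S.Nonempty →
      ({T' ∈ (𝒜 : Set (Set V)) | T ∩ T' = S}.ncard : ℝ) ^ a * r
        ≤ C * (𝒜.card : ℝ) ^ (a - S.ncard)) :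
    overlapSum 𝒜 δ ≤ Λ * 2 ^ a * (C * Λ ^ a / r) ^ ((a : ℝ)⁻¹) := by
  have hΛ0 : 0 ≤ Λ := zero_le_one.trans hΛ1
  have hq : 0 ≤ C * Λ ^ a / r := div_nonneg (mul_nonneg hC (pow_nonneg hΛ0 a)) hr.le
  have hη0 : 0 ≤ (C * Λ ^ a / r) ^ ((a : ℝ)⁻¹) := Real.rpow_nonneg hq _
  refine (overlapSum_le 𝒜 hδ hη0 ha ?_).trans ?_
  · intro T hT S hS hS0
    have hM := h T hT S hS hS0
    set M : ℝ := ({T' ∈ (𝒜 : Set (Set V)) | T ∩ T' = S}.ncard : ℝ)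
    have hM0 : 0 ≤ M := Nat.cast_nonneg _
    have hMδ : 0 ≤ M * δ ^ (a - S.ncard) := mul_nonneg hM0 (pow_nonneg hδ _)
    rw [← Real.pow_rpow_inv_natCast hMδ ha0]
    refine Real.rpow_le_rpow (pow_nonneg hMδ a) ?_ (inv_nonneg.2 (Nat.cast_nonneg a))
    rw [le_div_iff₀ hr, mul_pow, ← pow_mul, mul_comm (a - S.ncard), pow_mul]
    calc M ^ a * (δ ^ a) ^ (a - S.ncard) * r
        = (M ^ a * r) * (δ ^ a) ^ (a - S.ncard) := by ring
      _ ≤ (C * (𝒜.card : ℝ) ^ (a - S.ncard)) * (δ ^ a) ^ (a - S.ncard) :=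
          mul_le_mul_of_nonneg_right hM (pow_nonneg (pow_nonneg hδ a) _)
      _ = C * (𝒜.card * δ ^ a) ^ (a - S.ncard) := by rw [mul_pow]; ring
      _ ≤ C * Λ ^ (a - S.ncard) := by gcongr
      _ ≤ C * Λ ^ a := by
          gcongr
          omega
  · gcongr

theorem countTendstoPoisson_of_ncard_inter_le {ι : Type*} {l : Filter ι} {V : ι → Type*}
    [∀ i, Finite (V i)] (A : ∀ i, Set (Set (V i))) {δ : ι → unitInterval}
    (hδ : ∀ i, 0 < δ i ∧ δ i < 1) {lam : ℝ≥0} {a : ℕ} (ha0 : a ≠ 0)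
    (ha : ∀ i, ∀ T ∈ A i, T.ncard = a)
    (hexp : Tendsto (fun i ↦ expectedCount (A i) a (δ i)) l (𝓝 lam))
    {r : ι → ℝ} (hr : Tendsto r l atTop) (C : ℝ)
    (hcard : ∀ᶠ i in l, r i ≤ C * (A i).ncard)
    (hinter : ∀ᶠ i in l, ∀ T ∈ A i, ∀ S ⊂ T, S.Nonempty →
      ({T' ∈ A i | T ∩ T' = S}.ncard : ℝ) ^ a * r i ≤ C * ((A i).ncard : ℝ) ^ (a - S.ncard)) :
    CountTendstoPoisson l A δ lam := by
  obtain ⟨𝒜, rfl⟩ : ∃ 𝒜 : ∀ i, Finset (Set (V i)), A = fun i ↦ (𝒜 i : Set (Set (V i))) :=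
    ⟨fun i ↦ (A i).toFinite.toFinset, by simp⟩
  simp only [Set.ncard_coe_finset, Finset.mem_coe, expectedCount] at *
  have hδ0 (i) : (0 : ℝ) ≤ δ i := (δ i).2.1
  have hpos : ∀ᶠ i in l, 0 < r i := hr.eventually_gt_atTop 0
  -- The sign of `C` is not assumed; it follows wherever `0 < r i ≤ C * |𝒜 i|`.
  have hC : ∀ᶠ i in l, 0 ≤ C := by
    filter_upwards [hpos, hcard] with i h1 h2
    by_contra! hC
    have := mul_nonpos_of_nonpos_of_nonneg hC.le (Nat.cast_nonneg (α := ℝ) (𝒜 i).card)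
    linarith
  have hΛ : ∀ᶠ i in l, ((𝒜 i).card : ℝ) * (δ i : ℝ) ^ a ≤ lam + 1 :=
    hexp.eventually_le_const (by simp)
  have hinv (c : ℝ) : Tendsto (fun i ↦ c / r i) l (𝓝 0) := hr.const_div_atTop c
  refine countTendstoPoisson_of_tendsto_overlapSum 𝒜 (fun i ↦ (hδ i).2) ha0 ha hexp ?_ ?_
  · have hη : Tendsto (fun i ↦ (lam + 1) * 2 ^ a
        * (C * (lam + 1) ^ a / r i) ^ ((a : ℝ)⁻¹)) l (𝓝 (0 : ℝ)) := by
      have h := ((hinv (C * (lam + 1) ^ a)).rpow_const (p := (a : ℝ)⁻¹)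
        (.inr (inv_nonneg.2 (Nat.cast_nonneg a)))).const_mul (((lam : ℝ) + 1) * 2 ^ a)
      rwa [Real.zero_rpow (inv_ne_zero (Nat.cast_ne_zero.2 ha0)), mul_zero] at h
    refine squeeze_zero' (.of_forall fun i ↦ ?_) ?_ hη
    · exact Finset.sum_nonneg fun _ _ ↦ Finset.sum_nonneg fun _ _ ↦ pow_nonneg (hδ0 i) _
    filter_upwards [hΛ, hpos, hC, hinter] with i h1 h2 h3 h4
    exact overlapSum_le_of_ncard_inter_le (𝒜 i) (hδ0 i) (by simp) h3 h2 ha0 (ha i) h1 h4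
  · refine squeeze_zero' (.of_forall fun i ↦ pow_nonneg (hδ0 i) a) ?_ (hinv (C * (lam + 1)))
    filter_upwards [hΛ, hpos, hC, hcard] with i h1 h2 h3 h4
    rw [le_div_iff₀ h2]
    calc (δ i : ℝ) ^ a * r i ≤ (δ i : ℝ) ^ a * (C * (𝒜 i).card) :=
          mul_le_mul_of_nonneg_left h4 (pow_nonneg (hδ0 i) a)
      _ = C * ((𝒜 i).card * (δ i : ℝ) ^ a) := by ring
      _ ≤ _ := mul_le_mul_of_nonneg_left h1 h3

end PoissonLimit

/-! ### Families given by ordered tuples. -/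

section TupleFamilies

variable {V : Type*} [Finite V]

/-- Reserve one index `j ∉ J`: the entries outside `J` and `j` are chosen freely, then `hline`
leaves at most `L` values at `j`. -/
lemma ncard_agree_on_le {κ : Type*} [Finite κ] (P : Set (κ → V)) (L : ℕ)
    (hline : ∀ (j : κ) (x : κ → V), {y ∈ P | ∀ k ≠ j, y k = x k}.ncard ≤ L)
    (J : Set κ) (hJ : J ≠ Set.univ) (c : κ → V) :
    {x ∈ P | ∀ k ∈ J, x k = c k}.ncard ≤ L * Nat.card V ^ (Nat.card κ - 1 - J.ncard) := by
  classical
  have := Fintype.ofFinite V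
  have := Fintype.ofFinite κ
  obtain ⟨j, hj⟩ := (Set.ne_univ_iff_exists_notMem J).1 hJ
  set Q : Finset (κ → V) := {x ∈ P | ∀ k ∈ J, x k = c k}.toFinset
  rw [Set.ncard_eq_toFinset_card']
  let R : (κ → V) → (((insert j J)ᶜ : Set κ) → V) := fun x k ↦ x k
  refine (Finset.card_le_mul_card_image (f := R) Q L ?_).trans ?_
  · intro b hb
    obtain ⟨x, hx, rfl⟩ := Finset.mem_image.1 hb
    refine le_trans ?_ (hline j x)
    rw [← Set.ncard_coe_finset]
    refine Set.ncard_le_ncard fun y hy ↦ ?_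
    simp only [Finset.coe_filter, Set.mem_ofPred_eq, Q, Set.mem_toFinset] at hy hx
    refine ⟨hy.1.1, fun k hk ↦ ?_⟩
    by_cases hkJ : k ∈ J
    · rw [hy.1.2 k hkJ, hx.2 k hkJ]
    · exact congrFun hy.2 ⟨k, by simp [hk, hkJ]⟩
  · gcongr
    refine (Finset.card_le_univ _).trans (le_of_eq ?_)
    rw [← Nat.card_eq_fintype_card, Nat.card_fun, Nat.card_coe_set_eq, Set.ncard_compl,
      Set.ncard_insert_of_notMem hj]
    congr 1
    omega

/-- The first factor counts the ways to assign positions in the tuple to the points of `S`; the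
second counts tuples with those entries fixed. -/
lemma ncard_range_superset_le {κ : Type*} [Finite κ] (P : Set (κ → V)) (L : ℕ)
    (hline : ∀ (j : κ) (x : κ → V), {y ∈ P | ∀ k ≠ j, y k = x k}.ncard ≤ L)
    (S : Set V) (hS : S.ncard < Nat.card κ) :
    {T ∈ Set.range '' P | S ⊆ T}.ncard ≤
      Nat.card κ ^ S.ncard * (L * Nat.card V ^ (Nat.card κ - 1 - S.ncard)) := by
  classical
  have := Fintype.ofFinite V
  have := Fintype.ofFinite κ
  have := Fintype.ofFinite S
  have hsub : {T ∈ Set.range '' P | S ⊆ T} ⊆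
      ⋃ g ∈ (Finset.univ : Finset (S → κ)), Set.range '' {x ∈ P | ∀ v : S, x (g v) = v} := by
    rintro T ⟨⟨x, hx, rfl⟩, hST⟩
    choose g hg using fun v : S ↦ hST v.2
    simp only [Finset.mem_univ, Set.iUnion_true, Set.mem_iUnion]
    exact ⟨g, x, ⟨hx, hg⟩, rfl⟩
  refine (Set.ncard_le_ncard hsub).trans ((Finset.set_ncard_biUnion_le _ _).trans ?_)
  refine (Finset.sum_le_card_nsmul _ _ (L * Nat.card V ^ (Nat.card κ - 1 - S.ncard)) ?_).trans ?_
  · intro g _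
    refine (Set.ncard_image_le (Set.toFinite _)).trans ?_
    rcases Set.eq_empty_or_nonempty {x ∈ P | ∀ v : S, x (g v) = v} with h | ⟨c, hc, hcg⟩
    · rw [h]
      simp
    have hg : Function.Injective g := fun u v huv ↦ by
      rw [Subtype.ext_iff, ← hcg u, ← hcg v, huv]
    have hJ : (Set.range g).ncard = S.ncard := by
      rw [Set.ncard, Set.encard, ENat.card_congr (Equiv.ofInjective g hg).symm]
      rfl
    have h := ncard_agree_on_le P L hline (Set.range g)
      (fun h ↦ by rw [h, Set.ncard_univ] at hJ; omega) c
    rw [hJ] at h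
    refine le_trans (Set.ncard_le_ncard ?_) h
    rintro x ⟨hx, hxg⟩
    refine ⟨hx, ?_⟩
    rintro _ ⟨v, rfl⟩
    rw [hxg, hcg]
  · rw [smul_eq_mul, Finset.card_univ, ← Nat.card_eq_fintype_card, Nat.card_fun,
      Nat.card_coe_set_eq]

/-- A member has room for at most `a ^ |κ|` tuples. The map `f` is general because a plane is
spanned by its tuple rather than equal to its range. -/
lemma ncard_le_pow_mul_ncard {κ : Type*} [Finite κ] (P : Set (κ → V)) {A : Set (Set V)}
    {a : ℕ} (hA : ∀ T ∈ A, T.ncard ≤ a) (f : (κ → V) → Set V) (hf : ∀ x ∈ P, f x ∈ A)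
    (hxf : ∀ x ∈ P, ∀ k, x k ∈ f x) :
    P.ncard ≤ a ^ Nat.card κ * A.ncard := by
  classical
  have := Fintype.ofFinite V
  have := Fintype.ofFinite κ
  rw [Set.ncard_eq_toFinset_card' P]
  refine (Finset.card_le_mul_card_image (f := f) P.toFinset (a ^ Nat.card κ) ?_).trans ?_
  · intro T hT
    obtain ⟨x, hx, rfl⟩ := Finset.mem_image.1 hT
    have hsub : ((P.toFinset.filter (f · = f x)) : Set (κ → V)) ⊆
        Set.univ.pi fun _ : κ ↦ f x := by
      intro y hy
      simp only [Finset.coe_filter, Set.mem_toFinset, Set.mem_ofPred_eq] at hy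
      intro k _
      rw [← hy.2]
      exact hxf y hy.1 k
    rw [← Set.ncard_coe_finset]
    refine (Set.ncard_le_ncard hsub).trans ?_
    have : (Set.univ.pi fun _ : κ ↦ f x) = (Fintype.piFinset fun _ : κ ↦ (f x).toFinset) := by
      simp
    rw [this, Set.ncard_coe_finset, Fintype.card_piFinset, Finset.prod_const, Finset.card_univ,
      ← Nat.card_eq_fintype_card, ← Set.ncard_eq_toFinset_card']
    exact Nat.pow_le_pow_left (hA _ (hf x (by simpa using hx))) _
  · gcongr
    rw [← Set.ncard_coe_finset]
    refine Set.ncard_le_ncard ?_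
    intro T hT
    simp only [Finset.coe_image, Set.coe_toFinset] at hT
    obtain ⟨x, hx, rfl⟩ := hT
    exact hf x hx

lemma ncard_range_of_injective {κ W : Type*} {x : κ → W} (hx : Function.Injective x) :
    (Set.range x).ncard = Nat.card κ := by
  rw [← Set.image_univ, Set.ncard_image_of_injective _ hx, Set.ncard_univ]

/-- Poisson convergence for families of ranges of tuples: the admissible tuples are determined, up
to at most `L` choices, by all but one of their entries, and there are of the order of
`|V| ^ (a - 1) * L` of them, where `L` is negligible compared with `|V|`. -/
theorem countTendstoPoisson_range_image {ι : Type*} {l : Filter ι} {V : ι → Type*}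
    [∀ i, Finite (V i)] {a : ℕ} (ha : 2 ≤ a) (P : ∀ i, Set (Fin a → V i))
    (hinj : ∀ i, ∀ x ∈ P i, Function.Injective x) {δ : ι → unitInterval}
    (hδ : ∀ i, 0 < δ i ∧ δ i < 1) {lam : ℝ≥0}
    (hexp : Tendsto (fun i ↦ expectedCount (Set.range '' P i) a (δ i)) l (𝓝 lam))
    (L : ι → ℕ) (hL : ∀ᶠ i in l, 0 < L i)
    (hr : Tendsto (fun i ↦ (Nat.card (V i) : ℝ) / L i) l atTop)
    (hline : ∀ᶠ i in l, ∀ (j : Fin a) (x : Fin a → V i),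
      {y ∈ P i | ∀ k ≠ j, y k = x k}.ncard ≤ L i)
    (D : ℕ) (hP : ∀ᶠ i in l, Nat.card (V i) ^ (a - 1) * L i ≤ D * (P i).ncard) :
    CountTendstoPoisson l (fun i ↦ Set.range '' P i) δ lam := by
  have hcardT (i) : ∀ T ∈ Set.range '' P i, T.ncard = a := by
    rintro _ ⟨x, hx, rfl⟩
    simpa using ncard_range_of_injective (hinj i x hx)
  have hlow : ∀ᶠ i in l, Nat.card (V i) ^ (a - 1) * L i
      ≤ (D + 1) * a ^ a * (Set.range '' P i).ncard := by
    filter_upwards [hP] with i hi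
    have h := ncard_le_pow_mul_ncard (P i) (fun T hT ↦ (hcardT i T hT).le) Set.range
      (fun x hx ↦ ⟨x, hx, rfl⟩) (fun x _ k ↦ ⟨k, rfl⟩)
    rw [Nat.card_eq_fintype_card, Fintype.card_fin] at h
    calc _ ≤ D * (P i).ncard := hi
      _ ≤ (D + 1) * (a ^ a * (Set.range '' P i).ncard) := by gcongr; omega
      _ = _ := by ring
  have hLN : ∀ᶠ i in l, L i ≤ Nat.card (V i) := by
    filter_upwards [hr.eventually_ge_atTop 1, hL] with i h1 h2
    have h2' : (0 : ℝ) < L i := by exact_mod_cast h2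
    rw [one_le_div h2'] at h1
    exact_mod_cast h1
  -- Using `D + 1` keeps `B` positive even when `D = 0`.
  set B : ℕ := (D + 1) * a ^ a
  have hB : 1 ≤ B := Nat.mul_pos (by omega) (by positivity)
  refine countTendstoPoisson_of_ncard_inter_le _ hδ (by omega : a ≠ 0) hcardT hexp hr
    (((a ^ a) ^ a * B ^ a : ℕ) : ℝ) ?_ ?_
  · filter_upwards [hL, hlow] with i h1 h2
    have h1' : (0 : ℝ) < L i := by exact_mod_cast h1
    rw [div_le_iff₀ h1']
    norm_cast
    calc Nat.card (V i) ≤ Nat.card (V i) ^ (a - 1) := Nat.le_self_pow (by omega) _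
      _ ≤ Nat.card (V i) ^ (a - 1) * L i := Nat.le_mul_of_pos_right _ h1
      _ ≤ B * (Set.range '' P i).ncard := h2
      _ ≤ B ^ a * (Set.range '' P i).ncard := by
          gcongr
          exact Nat.le_self_pow (by omega) _
      _ ≤ (a ^ a) ^ a * B ^ a * (Set.range '' P i).ncard := by
          gcongr
          exact Nat.le_mul_of_pos_left _ (by positivity)
      _ ≤ _ := Nat.le_mul_of_pos_right _ h1
  · filter_upwards [hL, hlow, hLN, hline] with i h1 h2 h3 h4 T hT S hS hS0
    have h1' : (0 : ℝ) < L i := by exact_mod_cast h1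
    rw [mul_div_assoc', div_le_iff₀ h1']
    norm_cast
    have hTa := hcardT i T hT
    have hSa : S.ncard < a := by rw [← hTa]; exact Set.ncard_lt_ncard hS
    have hS1 : 0 < S.ncard := (Set.ncard_pos).2 hS0
    have hM := ncard_range_superset_le (P i) (L i) h4 S (by simpa using hSa)
    rw [Nat.card_eq_fintype_card, Fintype.card_fin] at hM
    have hM' : {T' ∈ Set.range '' P i | T ∩ T' = S}.ncard
        ≤ a ^ a * (L i * Nat.card (V i) ^ (a - 1 - S.ncard)) := by
      refine le_trans (Set.ncard_le_ncard ?_) (hM.trans ?_)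
      · rintro T' ⟨hT', rfl⟩
        exact ⟨hT', Set.inter_subset_right⟩
      · gcongr
        omega
    obtain ⟨s, hs⟩ : ∃ s, S.ncard = s + 1 := ⟨S.ncard - 1, by omega⟩
    obtain ⟨k, hk⟩ : ∃ k, a = s + 1 + 1 + k := ⟨a - (s + 1 + 1), by omega⟩
    have e1 : a - 1 - S.ncard = k := by omega
    have e2 : a - S.ncard = k + 1 := by omega
    have e3 : a - 1 = s + 1 + k := by omega
    rw [e1] at hM'
    rw [e3] at h2
    rw [e2]
    set N := Nat.card (V i)
    set M := {T' ∈ Set.range '' P i | T ∩ T' = S}.ncard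
    set Z := (Set.range '' P i).ncard
    -- With `|S| = s + 1`, the two sides differ, up to constants, exactly by exchanging `L ^ s` for
    -- `N ^ s`.
    have hsL : L i ^ s ≤ N ^ s := Nat.pow_le_pow_left h3 s
    calc M ^ a * N ≤ (a ^ a * (L i * N ^ k)) ^ a * N := by gcongr
      _ = (a ^ a) ^ a * (L i ^ a * (N ^ k) ^ a * N) := by ring
      _ = (a ^ a) ^ a * (L i ^ s * (L i ^ (k + 2) * N ^ (k * a + 1))) := by
          congr 1
          rw [← pow_mul]
          conv_lhs => rw [show L i ^ a = L i ^ (s + (k + 2)) by congr 1; omega]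
          ring
      _ ≤ (a ^ a) ^ a * (N ^ s * (L i ^ (k + 2) * N ^ (k * a + 1))) := by gcongr
      _ = (a ^ a) ^ a * ((N ^ (s + 1 + k) * L i) ^ (k + 1) * L i) := by
          have e4 : (s + 1 + k) * (k + 1) = s + (k * a + 1) := by rw [hk]; ring
          rw [mul_pow (N ^ (s + 1 + k)), ← pow_mul N (s + 1 + k), e4]
          ring
      _ ≤ (a ^ a) ^ a * ((B * Z) ^ (k + 1) * L i) := by gcongr
      _ = (a ^ a) ^ a * B ^ (k + 1) * Z ^ (k + 1) * L i := by rw [mul_pow]; ring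
      _ ≤ _ := by
          gcongr
          omega

end TupleFamilies

/-! ### Arithmetic progressions and parallelograms. -/

section Families

/-- Lower bounds on tuple counts come from injective parametrisations in which the second choice may
depend on the first. -/
lemma card_mul_le_ncard {α β γ : Type*} [Finite γ] (s : Finset α) (t : α → Finset β) (m : ℕ)
    (ht : ∀ x ∈ s, m ≤ (t x).card) (f : α → β → γ) (P : Set γ)
    (hf : ∀ x ∈ s, ∀ y ∈ t x, f x y ∈ P)
    (hinj : ∀ x ∈ s, ∀ y ∈ t x, ∀ x' ∈ s, ∀ y' ∈ t x', f x y = f x' y' → x = x' ∧ y = y') :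
    s.card * m ≤ P.ncard := by
  calc s.card * m ≤ (s.sigma t).card := by
        rw [Finset.card_sigma, ← smul_eq_mul]
        exact Finset.card_nsmul_le_sum _ _ _ ht
    _ = ((s.sigma t : Finset (Σ _ : α, β)) : Set (Σ _ : α, β)).ncard :=
        (Set.ncard_coe_finset _).symm
    _ ≤ P.ncard := by
        refine Set.ncard_le_ncard_of_injOn (fun p ↦ f p.1 p.2) ?_ ?_
        · rintro ⟨x, y⟩ h
          simp only [Finset.coe_sigma, Set.mem_sigma_iff, Finset.mem_coe] at h
          exact hf x h.1 y h.2
        · rintro ⟨x, y⟩ h ⟨x', y'⟩ h' he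
          simp only [Finset.coe_sigma, Set.mem_sigma_iff, Finset.mem_coe] at h h'
          obtain ⟨rfl, rfl⟩ := hinj x h.1 y h.2 x' h'.1 y' h'.2 he
          rfl

/-- Positivity of the limit rules out degenerate parameters: dimension 0, and characteristic 2 for
progressions. -/
lemma eventually_nonempty_of_tendsto_expectedCount {ι : Type*} {l : Filter ι} {V : ι → Type*}
    {A : ∀ i, Set (Set (V i))} {a : ℕ} {δ : ι → unitInterval} {lam : ℝ≥0} (hlam : 0 < lam)
    (hexp : Tendsto (fun i ↦ expectedCount (A i) a (δ i)) l (𝓝 (lam : ℝ))) :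
    ∀ᶠ i in l, (A i).Nonempty := by
  have hlam' : (0 : ℝ) < lam := hlam
  filter_upwards [hexp.eventually_const_lt hlam'] with i hi
  by_contra! h
  simp [expectedCount, h] at hi

lemma natCard_fin_fun (F : Type*) (n : ℕ) : Nat.card (Fin n → F) = Nat.card F ^ n := by
  simp [Nat.card_fun]

lemma add_le_two_mul_pow {q n : ℕ} (hq : 2 ≤ q) (hn : n ≠ 0) : q + n ≤ 2 * q ^ n := by
  have h1 : q ≤ q ^ n := Nat.le_self_pow hn q
  have h2 : n ≤ q ^ n := (Nat.lt_pow_self hq).le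
  omega

lemma tendsto_natCard_atTop {ι : Type*} {l : Filter ι} {n : ι → ℕ} (F : ι → Type*)
    [∀ i, Field (F i)] [∀ i, Finite (F i)]
    (h : Tendsto (fun i ↦ Nat.card (F i) + n i) l atTop)
    (hn : ∀ᶠ i in l, n i ≠ 0) :
    Tendsto (fun i ↦ Nat.card (Fin (n i) → F i)) l atTop := by
  rw [tendsto_atTop] at h ⊢
  intro b
  filter_upwards [h (2 * b), hn] with i h1 h2
  have h3 := add_le_two_mul_pow (Finite.one_lt_card (α := F i)) h2
  rw [natCard_fin_fun]
  omega

/-- The non-degenerate ordered three-term progressions. -/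
def orderedThreeAPs (V : Type*) [AddCommGroup V] : Set (Fin 3 → V) :=
  {x | Function.Injective x ∧ x 0 + x 2 = x 1 + x 1}

lemma injective_fin_three_iff {V : Type*} (x : Fin 3 → V) :
    Function.Injective x ↔ x 0 ≠ x 1 ∧ x 0 ≠ x 2 ∧ x 1 ≠ x 2 := by
  refine ⟨fun h ↦ ⟨h.ne (by decide), h.ne (by decide), h.ne (by decide)⟩, fun ⟨h1, h2, h3⟩ ↦ ?_⟩
  intro i j hij
  fin_cases i <;> fin_cases j <;> simp_all

lemma range_fin_three {V : Type*} (x : Fin 3 → V) : Set.range x = {x 0, x 1, x 2} := by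
  ext y
  simp [Fin.exists_fin_succ, eq_comm]

lemma threeAPs_eq_range_image (F : Type*) [Field F] (n : ℕ) :
    threeAPs F n = Set.range '' orderedThreeAPs (Fin n → F) := by
  ext T
  constructor
  · rintro ⟨x, v, h1, h2, h3, rfl⟩
    refine ⟨![x, x + v, x + (2 : F) • v], ⟨?_, ?_⟩, ?_⟩
    · rw [injective_fin_three_iff]
      exact ⟨h1, h2, h3⟩
    · simp [two_smul]
      abel
    · rw [range_fin_three]
      simp
  · rintro ⟨x, ⟨hx, h⟩, rfl⟩
    rw [injective_fin_three_iff] at hx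
    have h1 : x 0 + (x 1 - x 0) = x 1 := by abel
    have h2 : x 0 + (2 : F) • (x 1 - x 0) = x 2 := by
      rw [two_smul, eq_sub_of_add_eq' h]
      abel
    refine ⟨x 0, x 1 - x 0, ?_⟩
    rw [h1, h2, range_fin_three]
    exact ⟨hx.1, hx.2.1, hx.2.2, rfl⟩

lemma ncard_le_one_of_forall_eq {α : Type*} {s : Set α} (h : ∀ x ∈ s, ∀ y ∈ s, x = y) :
    s.ncard ≤ 1 := by
  rcases s.eq_empty_or_nonempty with rfl | ⟨x, hx⟩
  · simp
  · rw [Set.eq_singleton_iff_unique_mem.2 ⟨hx, fun y hy ↦ h y hy x hx⟩, Set.ncard_singleton]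

/-- In characteristic 2 the outer terms of a progression coincide. -/
lemma two_ne_zero_of_mem_orderedThreeAPs {F : Type*} [Field F] {n : ℕ} {x : Fin 3 → Fin n → F}
    (hx : x ∈ orderedThreeAPs (Fin n → F)) : (2 : F) ≠ 0 := by
  intro h2
  have hd (v : Fin n → F) : v + v = 0 := by rw [← two_smul F, h2, zero_smul]
  have h := hx.2
  rw [hd] at h
  refine hx.1.ne (by decide : (0 : Fin 3) ≠ 2) ?_
  rw [eq_neg_of_add_eq_zero_left h, neg_eq_iff_add_eq_zero]
  exact hd _

lemma ncard_orderedThreeAPs_line_le {F : Type*} [Field F] {n : ℕ} (j : Fin 3)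
    (x : Fin 3 → Fin n → F) :
    {y ∈ orderedThreeAPs (Fin n → F) | ∀ k ≠ j, y k = x k}.ncard ≤ 1 := by
  refine ncard_le_one_of_forall_eq ?_
  rintro y ⟨hy, hyx⟩ z ⟨hz, hzx⟩
  have h2 := two_ne_zero_of_mem_orderedThreeAPs hy
  have hyz (k) (hk : k ≠ j) : y k = z k := (hyx k hk).trans (hzx k hk).symm
  have hj : y j = z j := by
    have h := hy.2
    have h' := hz.2
    fin_cases j
    · have e1 := hyz 1 (by decide)
      have e2 := hyz 2 (by decide)
      rw [e1, e2, ← h'] at h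
      exact add_right_cancel h
    -- Recovering the middle term requires dividing by 2.
    · have e1 := hyz 0 (by decide)
      have e2 := hyz 2 (by decide)
      rw [e1, e2, h', ← two_smul F, ← two_smul F] at h
      exact (smul_right_injective _ h2 h).symm
    · have e1 := hyz 0 (by decide)
      have e2 := hyz 1 (by decide)
      rw [e1, e2, ← h'] at h
      exact add_left_cancel h
  funext k
  by_cases hk : k = j
  · rw [hk, hj]
  · exact hyz k hk

lemma natCard_sq_le_ncard_orderedThreeAPs {F : Type*} [Field F] [Finite F] {n : ℕ}
    (h : (orderedThreeAPs (Fin n → F)).Nonempty) :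
    Nat.card (Fin n → F) ^ 2 ≤ 2 * (orderedThreeAPs (Fin n → F)).ncard := by
  classical
  have := Fintype.ofFinite F
  obtain ⟨x, hx⟩ := h
  have h2 := two_ne_zero_of_mem_orderedThreeAPs hx
  have hN : 1 < Nat.card (Fin n → F) := by
    have : Nontrivial (Fin n → F) := ⟨x 0, x 1, hx.1.ne (by decide)⟩
    exact Finite.one_lt_card
  have hle : (Finset.univ : Finset (Fin n → F)).card * (Nat.card (Fin n → F) - 1) ≤
      (orderedThreeAPs (Fin n → F)).ncard := by
    refine card_mul_le_ncard Finset.univ (fun x ↦ Finset.univ.erase x) _ ?_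
      (fun x y ↦ ![x, y, y + y - x]) _ ?_ ?_
    · intro x _
      rw [Finset.card_erase_of_mem (Finset.mem_univ _), Nat.card_eq_fintype_card,
        Finset.card_univ]
    · intro x _ y hy
      have hyx : y ≠ x := Finset.ne_of_mem_erase hy
      refine ⟨?_, ?_⟩
      · rw [injective_fin_three_iff]
        refine ⟨hyx.symm, fun h ↦ ?_, fun h ↦ ?_⟩
        · replace h : x = y + y - x := h
          rw [eq_sub_iff_add_eq, ← two_smul F, ← two_smul F] at h
          exact hyx (smul_right_injective _ h2 h).symm
        · replace h : y = y + y - x := h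
          rw [eq_sub_iff_add_eq] at h
          exact hyx (add_left_cancel h).symm
      · simp
    · intro x _ y _ x' _ y' _ h
      exact ⟨congrFun h 0, congrFun h 1⟩
  rw [Finset.card_univ, ← Nat.card_eq_fintype_card] at hle
  have h3 : Nat.card (Fin n → F) ≤ 2 * (Nat.card (Fin n → F) - 1) := by omega
  nlinarith

theorem countTendstoPoisson_threeAPs {ι : Type*} {l : Filter ι} {n : ι → ℕ}
    {δ : ι → unitInterval} (hδ : ∀ i, 0 < δ i ∧ δ i < 1) {lam : ℝ≥0} (hlam : 0 < lam)
    (F : ι → Type*) [∀ i, Field (F i)] [∀ i, Finite (F i)]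
    (hqn : Tendsto (fun i ↦ Nat.card (F i) + n i) l atTop)
    (hexp : Tendsto (fun i ↦ expectedCount (threeAPs (F i) (n i)) 3 (δ i)) l (𝓝 (lam : ℝ))) :
    CountTendstoPoisson l (fun i ↦ threeAPs (F i) (n i)) δ lam := by
  have hne := eventually_nonempty_of_tendsto_expectedCount hlam hexp
  simp only [threeAPs_eq_range_image, Set.image_nonempty] at hne hexp ⊢
  have hn : ∀ᶠ i in l, n i ≠ 0 := by
    filter_upwards [hne] with i ⟨x, hx⟩ hn
    have : IsEmpty (Fin (n i)) := by rw [hn]; infer_instance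
    exact hx.1.ne (by decide : (0 : Fin 3) ≠ 1) (Subsingleton.elim _ _)
  refine countTendstoPoisson_range_image (by norm_num) _ (fun i x hx ↦ hx.1) hδ hexp (fun _ ↦ 1)
    (.of_forall fun _ ↦ one_pos) ?_ (.of_forall fun i ↦ ncard_orderedThreeAPs_line_le) 2 ?_
  · simpa [Function.comp_def] using tendsto_natCast_atTop_atTop.comp (tendsto_natCard_atTop F hqn hn)
  · filter_upwards [hne] with i hi
    simpa using natCard_sq_le_ncard_orderedThreeAPs hi

/-- The non-degenerate ordered parallelograms. -/
def orderedParallelograms (V : Type*) [AddCommGroup V] : Set (Fin 4 → V) :=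
  {x | Function.Injective x ∧ x 0 + x 2 = x 1 + x 3}

/-- Both defining equations amount to equality of the two diagonal sums, so one suffices. -/
lemma parallelograms_eq_range_image (F : Type*) [Field F] (n : ℕ) :
    parallelograms F n = Set.range '' orderedParallelograms (Fin n → F) := by
  ext T
  constructor
  · rintro ⟨x, hx, rfl, σ, h, -⟩
    refine ⟨x ∘ σ, ⟨hx.comp σ.injective, ?_⟩, ?_⟩
    · simpa [add_comm] using sub_eq_sub_iff_add_eq_add.1 h
    · rw [Set.range_comp, σ.range_eq_univ, Set.image_univ]
  · rintro ⟨x, ⟨hx, h⟩, rfl⟩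
    refine ⟨x, hx, rfl, 1, ?_, ?_⟩
    · simp only [Equiv.Perm.coe_one, id_eq]
      rw [sub_eq_sub_iff_add_eq_add, h, add_comm]
    · simp only [Equiv.Perm.coe_one, id_eq]
      rw [sub_eq_sub_iff_add_eq_add, h]

lemma ncard_orderedParallelograms_line_le {V : Type*} [AddCommGroup V] (j : Fin 4)
    (x : Fin 4 → V) : {y ∈ orderedParallelograms V | ∀ k ≠ j, y k = x k}.ncard ≤ 1 := by
  refine ncard_le_one_of_forall_eq ?_
  rintro y ⟨hy, hyx⟩ z ⟨hz, hzx⟩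
  have hyz (k) (hk : k ≠ j) : y k = z k := (hyx k hk).trans (hzx k hk).symm
  have hj : y j = z j := by
    have h := hy.2
    have h' := hz.2
    fin_cases j
    · rw [hyz 1 (by decide), hyz 2 (by decide), hyz 3 (by decide), ← h'] at h
      exact add_right_cancel h
    · rw [hyz 0 (by decide), hyz 2 (by decide), hyz 3 (by decide), h'] at h
      exact (add_right_cancel h).symm
    · rw [hyz 0 (by decide), hyz 1 (by decide), hyz 3 (by decide), ← h'] at h
      exact add_left_cancel h
    · rw [hyz 0 (by decide), hyz 1 (by decide), hyz 2 (by decide), h'] at h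
      exact (add_left_cancel h).symm
  funext k
  by_cases hk : k = j
  · rw [hk, hj]
  · exact hyz k hk

lemma natCard_cube_le_ncard_orderedParallelograms {V : Type*} [AddCommGroup V] [Finite V]
    (hN : 6 ≤ Nat.card V) :
    Nat.card V ^ 3 ≤ 4 * (orderedParallelograms V).ncard := by
  classical
  have := Fintype.ofFinite V
  have hle : (Finset.univ : Finset V).offDiag.card * (Nat.card V - 3) ≤
      (orderedParallelograms V).ncard := by
    -- The last vertex must avoid the first two, and also `2 * p.1 - p.2`, which would make the
    -- third vertex equal to the first.
    refine card_mul_le_ncard Finset.univ.offDiag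
      (fun p ↦ ({p.1, p.2, p.1 + p.1 - p.2} : Finset V)ᶜ) _ ?_
      (fun p y ↦ ![p.1, p.2, p.2 + y - p.1, y]) _ ?_ ?_
    · intro p _
      rw [Finset.card_compl, ← Nat.card_eq_fintype_card]
      exact Nat.sub_le_sub_left Finset.card_le_three _
    · rintro ⟨u, v⟩ huv y hy
      have huv' : u ≠ v := by simpa using huv
      simp only [Finset.mem_compl, Finset.mem_insert, Finset.mem_singleton, not_or] at hy
      refine ⟨?_, by simp⟩
      have h02 : u ≠ v + y - u := fun h ↦ hy.2.2 (by
        rw [eq_sub_iff_add_eq] at h ⊢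
        rw [h, add_comm])
      have h12 : v ≠ v + y - u := fun h ↦ hy.1 (by
        rw [eq_sub_iff_add_eq] at h
        exact (add_left_cancel h).symm)
      have h23 : v + y - u ≠ y := fun h ↦ huv' (by
        rw [sub_eq_iff_eq_add, add_comm] at h
        exact (add_left_cancel h).symm)
      intro i j hij
      fin_cases i <;> fin_cases j <;> simp_all [eq_comm]
    · rintro ⟨u, v⟩ _ y _ ⟨u', v'⟩ _ y' _ h
      exact ⟨Prod.ext (congrFun h 0) (congrFun h 1), congrFun h 3⟩
  rw [Finset.offDiag_card, Finset.card_univ, ← Nat.card_eq_fintype_card] at hle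
  obtain ⟨k, hk⟩ : ∃ k, Nat.card V = k + 6 := ⟨Nat.card V - 6, by omega⟩
  rw [hk] at hle ⊢
  have e1 : (k + 6) * (k + 6) - (k + 6) = (k + 6) * (k + 5) := by
    rw [← Nat.mul_sub_one]
    rfl
  have e2 : k + 6 - 3 = k + 3 := by omega
  rw [e1, e2] at hle
  nlinarith

theorem countTendstoPoisson_parallelograms {ι : Type*} {l : Filter ι} {n : ι → ℕ}
    {δ : ι → unitInterval} (hδ : ∀ i, 0 < δ i ∧ δ i < 1) {lam : ℝ≥0} (hlam : 0 < lam)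
    (F : ι → Type*) [∀ i, Field (F i)] [∀ i, Finite (F i)]
    (hqn : Tendsto (fun i ↦ Nat.card (F i) + n i) l atTop)
    (hexp : Tendsto (fun i ↦ expectedCount (parallelograms (F i) (n i)) 4 (δ i)) l
      (𝓝 (lam : ℝ))) :
    CountTendstoPoisson l (fun i ↦ parallelograms (F i) (n i)) δ lam := by
  have hne := eventually_nonempty_of_tendsto_expectedCount hlam hexp
  simp only [parallelograms_eq_range_image, Set.image_nonempty] at hne hexp ⊢
  have hn : ∀ᶠ i in l, n i ≠ 0 := by
    filter_upwards [hne] with i ⟨x, hx⟩ hn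
    have : IsEmpty (Fin (n i)) := by rw [hn]; infer_instance
    exact hx.1.ne (by decide : (0 : Fin 4) ≠ 1) (Subsingleton.elim _ _)
  have hcard := tendsto_natCard_atTop F hqn hn
  refine countTendstoPoisson_range_image (by norm_num) _ (fun i x hx ↦ hx.1) hδ hexp (fun _ ↦ 1)
    (.of_forall fun _ ↦ one_pos) ?_ (.of_forall fun i ↦ ncard_orderedParallelograms_line_le) 4 ?_
  · simpa [Function.comp_def] using tendsto_natCast_atTop_atTop.comp hcard
  · filter_upwards [hcard.eventually_ge_atTop 6] with i hi
    simpa using natCard_cube_le_ncard_orderedParallelograms hi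

end Families

/-! ### Right triangles. -/

section RightTriangles

/-- The ordered right triangles, with the right angle at the first vertex. -/
def orderedRightTriangles (F : Type*) [Field F] (n : ℕ) : Set (Fin 3 → Fin n → F) :=
  {x | Function.Injective x ∧ (x 1 - x 0) ⬝ᵥ (x 2 - x 0) = 0}

lemma rightTriangles_eq_range_image (F : Type*) [Field F] (n : ℕ) :
    rightTriangles F n = Set.range '' orderedRightTriangles F n := by
  ext T
  constructor
  · rintro ⟨x, hx, rfl, σ, h⟩
    refine ⟨x ∘ σ, ⟨hx.comp σ.injective, h⟩, ?_⟩
    rw [Set.range_comp, σ.range_eq_univ, Set.image_univ]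
  · rintro ⟨x, ⟨hx, h⟩, rfl⟩
    exact ⟨x, hx, rfl, 1, h⟩

variable {F : Type*} [Field F] [Finite F] {n : ℕ}

/-- Nondegeneracy of the dot product makes `u` a nonzero functional, even if `u` is isotropic, so
its kernel is a hyperplane. -/
lemma ncard_dotProduct_eq_zero {u : Fin n → F} (hu : u ≠ 0) :
    {z : Fin n → F | u ⬝ᵥ z = 0}.ncard = Nat.card F ^ (n - 1) := by
  have := Fintype.ofFinite F
  set φ : Module.Dual F (Fin n → F) := dotProductBilin F F u with hφ
  have hφ0 : φ ≠ 0 := by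
    intro h
    refine hu (dotProduct_eq_zero _ fun w ↦ ?_)
    have := LinearMap.congr_fun h w
    simpa [hφ] using this
  have h1 := Module.Dual.finrank_ker_add_one_of_ne_zero hφ0
  rw [Module.finrank_fin_fun] at h1
  have h2 : {z : Fin n → F | u ⬝ᵥ z = 0} = (LinearMap.ker φ : Set (Fin n → F)) := by
    ext z
    simp [hφ]
  rw [h2, ← Nat.card_coe_set_eq]
  change Nat.card (LinearMap.ker φ) = _
  rw [Module.natCard_eq_pow_finrank (K := F)]
  congr 1
  omega

lemma ncard_dotProduct_eq_le {u : Fin n → F} (hu : u ≠ 0) (c : F) :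
    {z : Fin n → F | u ⬝ᵥ z = c}.ncard ≤ Nat.card F ^ (n - 1) := by
  rcases Set.eq_empty_or_nonempty {z : Fin n → F | u ⬝ᵥ z = c} with h | ⟨w, hw⟩
  · simp [h]
  · rw [← ncard_dotProduct_eq_zero hu]
    refine Set.ncard_le_ncard_of_injOn (fun z ↦ z - w) (fun z hz ↦ ?_)
      (fun z _ z' _ h ↦ sub_left_injective h)
    simp only [Set.mem_ofPred_eq] at hz hw ⊢
    rw [dotProduct_sub, hz, hw, sub_self]

omit [Finite F] in
lemma card_quadratic_roots_le (s : Finset F) (a b c : F)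
    (h : ∀ t ∈ s, (a - t) * (b - t) = c) : s.card ≤ 2 := by
  classical
  rcases s.eq_empty_or_nonempty with rfl | ⟨t, ht⟩
  · simp
  · refine (Finset.card_le_card (t := {t, a + b - t}) fun t' ht' ↦ ?_).trans Finset.card_le_two
    have h1 : (t' - t) * (t' - (a + b - t)) = 0 := by
      linear_combination h t' ht' - h t ht
    rcases mul_eq_zero.1 h1 with h2 | h2
    · simp [sub_eq_zero.1 h2]
    · simp [sub_eq_zero.1 h2]

/-- With all coordinates but the first frozen, the condition is a monic quadratic in the first,
hence has at most two roots. -/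
lemma ncard_sub_dotProduct_sub_eq_zero_le (hn : n ≠ 0) (u v : Fin n → F) :
    {z : Fin n → F | (u - z) ⬝ᵥ (v - z) = 0}.ncard ≤ 2 * Nat.card F ^ (n - 1) := by
  classical
  have := Fintype.ofFinite F
  obtain ⟨m, rfl⟩ := Nat.exists_eq_succ_of_ne_zero hn
  rw [Set.ncard_eq_toFinset_card']
  refine (Finset.card_le_mul_card_image (f := Fin.tail) _ 2 ?_).trans ?_
  · intro g _
    rw [← Finset.card_image_of_injOn (f := fun z : Fin (m + 1) → F ↦ z 0)]
    · refine card_quadratic_roots_le _ (u 0) (v 0)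
        (-∑ i, (u (Fin.succ i) - g i) * (v (Fin.succ i) - g i)) ?_
      intro t ht
      obtain ⟨z, hz, rfl⟩ := Finset.mem_image.1 ht
      simp only [Finset.mem_filter, Set.mem_toFinset, Set.mem_ofPred_eq, dotProduct,
        Fin.sum_univ_succ, Pi.sub_apply] at hz
      obtain ⟨h1, rfl⟩ := hz
      simp only [Fin.tail]
      linear_combination h1
    · intro z hz z' hz' h
      simp only [Finset.coe_filter, Set.mem_ofPred_eq] at hz hz'
      rw [← Fin.cons_self_tail z, ← Fin.cons_self_tail z', hz.2, hz'.2]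
      simp only at h
      rw [h]
  · gcongr
    refine (Finset.card_le_univ _).trans (le_of_eq ?_)
    rw [← Nat.card_eq_fintype_card, natCard_fin_fun]
    rfl

/-- The right-angled vertex moves on a quadric, either other vertex on a hyperplane; only the
quadric needs the factor 2. -/
lemma ncard_orderedRightTriangles_line_le (hn : n ≠ 0) (j : Fin 3) (x : Fin 3 → Fin n → F) :
    {y ∈ orderedRightTriangles F n | ∀ k ≠ j, y k = x k}.ncard ≤ 2 * Nat.card F ^ (n - 1) := by
  rcases Set.eq_empty_or_nonempty {y ∈ orderedRightTriangles F n | ∀ k ≠ j, y k = x k}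
    with h | ⟨w, hw, hwx⟩
  · simp [h]
  have hinj : Set.InjOn (fun y : Fin 3 → Fin n → F ↦ y j)
      {y ∈ orderedRightTriangles F n | ∀ k ≠ j, y k = x k} := by
    rintro y ⟨_, hy⟩ z ⟨_, hz⟩ h
    funext k
    by_cases hk : k = j
    · rw [hk]
      exact h
    · rw [hy k hk, hz k hk]
  fin_cases j
  · refine le_trans (Set.ncard_le_ncard_of_injOn _ (fun y hy ↦ ?_) hinj)
      (ncard_sub_dotProduct_sub_eq_zero_le hn (x 1) (x 2))
    have h := hy.1.2
    rwa [hy.2 1 (by decide), hy.2 2 (by decide)] at h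
  · have hu : x 2 - x 0 ≠ 0 := by
      rw [← hwx 2 (by decide), ← hwx 0 (by decide)]
      exact sub_ne_zero.2 (hw.1.ne (by decide))
    refine (Set.ncard_le_ncard_of_injOn _ (fun y hy ↦ ?_) hinj).trans
      ((ncard_dotProduct_eq_le hu ((x 2 - x 0) ⬝ᵥ x 0)).trans (by omega))
    have h := hy.1.2
    rw [hy.2 2 (by decide), hy.2 0 (by decide), dotProduct_comm, dotProduct_sub] at h
    exact sub_eq_zero.1 h
  · have hu : x 1 - x 0 ≠ 0 := by
      rw [← hwx 1 (by decide), ← hwx 0 (by decide)]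
      exact sub_ne_zero.2 (hw.1.ne (by decide))
    refine (Set.ncard_le_ncard_of_injOn _ (fun y hy ↦ ?_) hinj).trans
      ((ncard_dotProduct_eq_le hu ((x 1 - x 0) ⬝ᵥ x 0)).trans (by omega))
    have h := hy.1.2
    rw [hy.2 1 (by decide), hy.2 0 (by decide), dotProduct_sub] at h
    exact sub_eq_zero.1 h

lemma natCard_sq_mul_le_ncard_orderedRightTriangles (hn : 2 ≤ n) (hq : 4 ≤ Nat.card F) :
    Nat.card (Fin n → F) ^ 2 * (2 * Nat.card F ^ (n - 1)) ≤
      8 * (orderedRightTriangles F n).ncard := by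
  classical
  have := Fintype.ofFinite F
  have hle : (Finset.univ : Finset (Fin n → F)).offDiag.card * (Nat.card F ^ (n - 1) - 2) ≤
      (orderedRightTriangles F n).ncard := by
    -- The third vertex ranges over the hyperplane through `p.1` orthogonal to `p.2 - p.1`, minus
    -- the two chosen points.
    refine card_mul_le_ncard Finset.univ.offDiag
      (fun p ↦ (Finset.univ.filter fun z ↦ (p.2 - p.1) ⬝ᵥ (z - p.1) = 0) \ {p.1, p.2}) _ ?_
      (fun p y ↦ ![p.1, p.2, y]) _ ?_ ?_
    · rintro ⟨u, v⟩ huv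
      have huv' : u ≠ v := by simpa using huv
      refine le_trans ?_ (Finset.le_card_sdiff _ _)
      refine tsub_le_tsub ?_ Finset.card_le_two
      rw [← ncard_dotProduct_eq_zero (sub_ne_zero.2 huv'.symm), ← Set.ncard_coe_finset]
      refine Set.ncard_le_ncard_of_injOn (fun z ↦ z + u) (fun z hz ↦ ?_)
        (fun z _ z' _ h ↦ add_left_injective u h)
      have hz' : (v - u) ⬝ᵥ z = 0 := hz
      simpa only [Finset.coe_filter, Finset.mem_univ, true_and, Set.mem_ofPred_eq,
        add_sub_cancel_right] using hz'
    · rintro ⟨u, v⟩ huv y hy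
      have huv' : u ≠ v := by simpa using huv
      simp only [Finset.mem_sdiff, Finset.mem_filter, Finset.mem_univ, true_and,
        Finset.mem_insert, Finset.mem_singleton, not_or] at hy
      refine ⟨?_, hy.1⟩
      rw [injective_fin_three_iff]
      exact ⟨huv', Ne.symm hy.2.1, Ne.symm hy.2.2⟩
    · rintro ⟨u, v⟩ _ y _ ⟨u', v'⟩ _ y' _ h
      exact ⟨Prod.ext (congrFun h 0) (congrFun h 1), congrFun h 2⟩
  rw [Finset.offDiag_card, Finset.card_univ, ← Nat.card_eq_fintype_card, natCard_fin_fun] at hle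
  rw [natCard_fin_fun]
  have hK : 4 ≤ Nat.card F ^ (n - 1) := hq.trans (Nat.le_self_pow (by omega) _)
  have hN : 2 ≤ Nat.card F ^ n := le_trans (by omega) (Nat.le_self_pow (n := n) (by omega) _)
  generalize Nat.card F ^ (n - 1) = K at *
  generalize Nat.card F ^ n = N at *
  have h1 : N * N ≤ 2 * (N * N - N) := by
    have : 2 * N ≤ N * N := Nat.mul_le_mul_right N hN
    omega
  have h2 : K ≤ 2 * (K - 2) := by omega
  calc N ^ 2 * (2 * K) = 2 * ((N * N) * K) := by ring
    _ ≤ 2 * ((2 * (N * N - N)) * (2 * (K - 2))) := by gcongr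
    _ = 8 * ((N * N - N) * (K - 2)) := by ring
    _ ≤ _ := by gcongr

theorem countTendstoPoisson_rightTriangles {ι : Type*} {l : Filter ι} {n : ι → ℕ}
    {δ : ι → unitInterval} (hδ : ∀ i, 0 < δ i ∧ δ i < 1) {lam : ℝ≥0}
    (F : ι → Type*) [∀ i, Field (F i)] [∀ i, Finite (F i)] (hn : ∀ i, 2 ≤ n i)
    (hq : Tendsto (fun i ↦ Nat.card (F i)) l atTop)
    (hexp : Tendsto (fun i ↦ expectedCount (rightTriangles (F i) (n i)) 3 (δ i)) l
      (𝓝 (lam : ℝ))) :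
    CountTendstoPoisson l (fun i ↦ rightTriangles (F i) (n i)) δ lam := by
  simp only [rightTriangles_eq_range_image] at hexp ⊢
  have hn0 (i) : n i ≠ 0 := by have := hn i; omega
  have hpos (i) : 0 < Nat.card (F i) := Nat.card_pos
  refine countTendstoPoisson_range_image (by norm_num) _ (fun i x hx ↦ hx.1) hδ hexp
    (fun i ↦ 2 * Nat.card (F i) ^ (n i - 1)) (.of_forall fun i ↦ ?_) ?_
    (.of_forall fun i ↦ ncard_orderedRightTriangles_line_le (hn0 i)) 8 ?_
  · exact Nat.mul_pos two_pos (pow_pos (hpos i) _)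
  -- The ratio `|V| / L` is exactly `q / 2`, so it is `q` that must grow.
  · have h : Tendsto (fun i ↦ (Nat.card (F i) : ℝ) / 2) l atTop :=
      (tendsto_natCast_atTop_atTop.comp hq).atTop_div_const two_pos
    refine h.congr fun i ↦ ?_
    have hp : (Nat.card (F i) : ℝ) ≠ 0 := by exact_mod_cast (hpos i).ne'
    rw [natCard_fin_fun]
    push_cast
    rw [← Nat.succ_pred_eq_of_ne_zero (hn0 i), Nat.succ_sub_one, pow_succ]
    field_simp
  · filter_upwards [hq.eventually_ge_atTop 4] with i hi
    exact natCard_sq_mul_le_ncard_orderedRightTriangles (hn i) hi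

end RightTriangles

/-! ### Affine planes. -/

section AffinePlanes

variable {F : Type*} [Field F] [Finite F] {n m : ℕ}

omit [Finite F] in
lemma ncard_submodule_eq_pow {V : Type*} [AddCommGroup V] [Module F V]
    [FiniteDimensional F V] (W : Submodule F V) :
    (W : Set V).ncard = Nat.card F ^ Module.finrank F W := by
  rw [← Nat.card_coe_set_eq]
  exact Module.natCard_eq_pow_finrank (K := F) (V := W)

omit [Finite F] in
lemma ncard_of_mem_affinePlanes {T : Set (Fin n → F)} (hT : T ∈ affinePlanes F n m) :
    T.ncard = Nat.card F ^ m := by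
  obtain ⟨W, x, hW, rfl⟩ := hT
  rw [Set.ncard_image_of_injective _ (add_right_injective x), ncard_submodule_eq_pow, hW]

/-- Each factor `q ^ n - q ^ i` with `i < n` is at least half of `q ^ n`. -/
lemma pow_le_two_pow_mul_card_linearIndependent (hm : m ≤ n) :
    Nat.card (Fin n → F) ^ m ≤
      2 ^ m * Nat.card {s : Fin m → Fin n → F // LinearIndependent F s} := by
  have := Fintype.ofFinite F
  rw [card_linearIndependent (by simpa using hm), ← Nat.card_eq_fintype_card,
    Module.finrank_fin_fun, natCard_fin_fun]
  calc (Nat.card F ^ n) ^ m = ∏ i : Fin m, Nat.card F ^ n := by simp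
    _ ≤ ∏ i : Fin m, 2 * (Nat.card F ^ n - Nat.card F ^ (i : ℕ)) := by
        refine Finset.prod_le_prod' fun i _ ↦ ?_
        have hq : 2 ≤ Nat.card F := Finite.one_lt_card
        have h : 2 * Nat.card F ^ (i : ℕ) ≤ Nat.card F ^ n := by
          calc 2 * Nat.card F ^ (i : ℕ) ≤ Nat.card F * Nat.card F ^ (i : ℕ) := by gcongr
            _ = Nat.card F ^ ((i : ℕ) + 1) := by ring
            _ ≤ Nat.card F ^ n := Nat.pow_le_pow_right (by omega) (by omega)
        omega
    _ = _ := by simp [Finset.prod_mul_distrib]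

/-- Count affinely independent `(m + 1)`-tuples: each spans a plane, and a plane of `q ^ m` points
contains at most `(q ^ m) ^ (m + 1)` of them. -/
lemma pow_le_mul_ncard_affinePlanes (hm : m ≤ n) :
    Nat.card (Fin n → F) ^ (m + 1) ≤
      2 ^ m * (Nat.card F ^ m) ^ (m + 1) * (affinePlanes F n m).ncard := by
  classical
  have := Fintype.ofFinite F
  set P : Set (Fin (m + 1) → Fin n → F) :=
    {y | LinearIndependent F fun k : Fin m ↦ y k.succ - y 0}
  have h1 : (Finset.univ : Finset (Fin n → F)).card *
      Nat.card {s : Fin m → Fin n → F // LinearIndependent F s} ≤ P.ncard := by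
    refine card_mul_le_ncard Finset.univ
      (fun _ ↦ Finset.univ.filter fun s : Fin m → Fin n → F ↦ LinearIndependent F s) _
      (fun x _ ↦ ?_) (fun x s ↦ Fin.cons x fun k ↦ s k + x) P ?_ ?_
    · rw [Nat.card_eq_fintype_card, Fintype.card_subtype]
    · intro x _ s hs
      simpa [P] using hs
    · intro x _ s _ x' _ s' _ h
      rw [Fin.cons_inj] at h
      obtain ⟨rfl, h⟩ := h
      exact ⟨rfl, funext fun k ↦ add_right_cancel (congrFun h k)⟩
  have h2 := ncard_le_pow_mul_ncard P
    (fun T hT ↦ (ncard_of_mem_affinePlanes (m := m) hT).le)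
    (fun y ↦ (fun w ↦ y 0 + w) ''
      (Submodule.span F (Set.range fun k : Fin m ↦ y k.succ - y 0) : Set (Fin n → F)))
    (fun y hy ↦ ⟨_, _, by simpa using finrank_span_eq_card hy, rfl⟩)
    (fun y _ k ↦ by
      refine ⟨y k - y 0, ?_, by simp⟩
      induction k using Fin.cases with
      | zero => simp
      | succ k => exact Submodule.subset_span ⟨k, rfl⟩)
  rw [Finset.card_univ, ← Nat.card_eq_fintype_card] at h1
  rw [Nat.card_eq_fintype_card (α := Fin (m + 1)), Fintype.card_fin] at h2
  calc Nat.card (Fin n → F) ^ (m + 1)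
      = Nat.card (Fin n → F) ^ m * Nat.card (Fin n → F) := pow_succ _ _
    _ ≤ 2 ^ m * Nat.card {s : Fin m → Fin n → F // LinearIndependent F s}
          * Nat.card (Fin n → F) :=
        Nat.mul_le_mul_right _ (pow_le_two_pow_mul_card_linearIndependent hm)
    _ = 2 ^ m * (Nat.card (Fin n → F) *
          Nat.card {s : Fin m → Fin n → F // LinearIndependent F s}) := by ring
    _ ≤ 2 ^ m * ((Nat.card F ^ m) ^ (m + 1) * (affinePlanes F n m).ncard) :=
        Nat.mul_le_mul_left _ (h1.trans h2)
    _ = _ := by ring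

-- Fix a complement `C` of `U`. By modularity `W = U ⊔ (C ⊓ W)`, so `W` is determined by a basis of
-- `C ⊓ W`.
omit [Finite F] in
lemma ncard_submodule_ge_le {V : Type*} [AddCommGroup V] [Module F V] [Finite V]
    (U : Submodule F V) (m : ℕ) :
    {W : Submodule F V | Module.finrank F W = m ∧ U ≤ W}.ncard ≤
      Nat.card V ^ (m - Module.finrank F U) := by
  obtain ⟨C, hC⟩ := Submodule.exists_isCompl U
  have hsub : {W : Submodule F V | Module.finrank F W = m ∧ U ≤ W} ⊆
      (fun w : Fin (m - Module.finrank F U) → V ↦ U ⊔ Submodule.span F (Set.range w)) ''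
        Set.univ := by
    rintro W ⟨hW, hUW⟩
    have h1 : U ⊔ C ⊓ W = W := by
      rw [← sup_inf_assoc_of_le C hUW, hC.sup_eq_top, top_inf_eq]
    have h2 : U ⊓ (C ⊓ W) = ⊥ := by rw [← inf_assoc, hC.inf_eq_bot, bot_inf_eq]
    have h3 := Submodule.finrank_sup_add_finrank_inf_eq U (C ⊓ W)
    rw [h1, h2, finrank_bot, hW] at h3
    have h4 : Module.finrank F ↥(C ⊓ W) = m - Module.finrank F U := by omega
    let b := Module.finBasisOfFinrankEq F ↥(C ⊓ W) h4
    refine ⟨fun i ↦ (b i : V), Set.mem_univ _, ?_⟩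
    have h5 : Submodule.span F (Set.range fun i ↦ (b i : V)) = C ⊓ W := by
      have := congrArg (Submodule.map (C ⊓ W).subtype) b.span_eq
      rw [Submodule.map_span, Submodule.map_top, Submodule.range_subtype, ← Set.range_comp]
        at this
      exact this
    change U ⊔ Submodule.span F (Set.range fun i ↦ (b i : V)) = W
    rw [h5, h1]
  refine (Set.ncard_le_ncard hsub (Set.toFinite _)).trans
    ((Set.ncard_image_le (Set.toFinite _)).trans ?_)
  rw [Set.ncard_univ, Nat.card_fun, Nat.card_eq_fintype_card (α := Fin _), Fintype.card_fin]

omit [Finite F] in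
lemma exists_eq_image_add_of_mem_affinePlanes {T : Set (Fin n → F)}
    (hT : T ∈ affinePlanes F n m) {s : Fin n → F} (hs : s ∈ T) :
    ∃ W : Submodule F (Fin n → F), Module.finrank F W = m ∧
      T = (fun w ↦ s + w) '' (W : Set (Fin n → F)) := by
  obtain ⟨W, x, hW, rfl⟩ := hT
  obtain ⟨w, hw, rfl⟩ := hs
  refine ⟨W, hW, ?_⟩
  ext y
  constructor
  · rintro ⟨v, hv, rfl⟩
    exact ⟨v - w, W.sub_mem hv hw, by simp⟩
  · rintro ⟨v, hv, rfl⟩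
    exact ⟨w + v, W.add_mem hw hv, (add_assoc _ _ _).symm⟩

/-- The witness `T'` shows that `S` is a plane of some dimension `k`. Based at a point of `S`, any
plane meeting `T` in `S` has a direction containing that of `S`. -/
lemma exists_ncard_inter_affinePlanes_le {T T' S : Set (Fin n → F)} (hT : T ∈ affinePlanes F n m)
    (hT' : T' ∈ affinePlanes F n m) (hS : S ⊂ T) (hS0 : S.Nonempty) (hTT' : T ∩ T' = S) :
    ∃ k < m, S.ncard = Nat.card F ^ k ∧
      {T' ∈ affinePlanes F n m | T ∩ T' = S}.ncard ≤ Nat.card (Fin n → F) ^ (m - k) := by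
  obtain ⟨s, hs⟩ := hS0
  have hs' : s ∈ T ∩ T' := by rw [hTT']; exact hs
  obtain ⟨W, hW, hTW⟩ := exists_eq_image_add_of_mem_affinePlanes hT hs'.1
  obtain ⟨W', hW', hTW'⟩ := exists_eq_image_add_of_mem_affinePlanes hT' hs'.2
  have hSU : S = (fun w ↦ s + w) '' ((W ⊓ W' : Submodule F (Fin n → F)) : Set (Fin n → F)) := by
    rw [← hTT', hTW, hTW', ← Set.image_inter (add_right_injective s)]
    rfl
  have hcard : S.ncard = Nat.card F ^ Module.finrank F ↥(W ⊓ W') := by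
    rw [hSU, Set.ncard_image_of_injective _ (add_right_injective s), ncard_submodule_eq_pow]
  refine ⟨Module.finrank F ↥(W ⊓ W'), ?_, hcard, ?_⟩
  · have h := Set.ncard_lt_ncard hS
    rw [hcard, ncard_of_mem_affinePlanes hT] at h
    exact (Nat.pow_lt_pow_iff_right (Finite.one_lt_card (α := F))).1 h
  · refine le_trans ?_ (ncard_submodule_ge_le (W ⊓ W') m)
    refine (Set.ncard_le_ncard (t := (fun Y : Submodule F (Fin n → F) ↦
      (fun w ↦ s + w) '' (Y : Set (Fin n → F))) '' {Y | Module.finrank F Y = m ∧ W ⊓ W' ≤ Y})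
      ?_ (Set.toFinite _)).trans (Set.ncard_image_le (Set.toFinite _))
    rintro R ⟨hR, hTR⟩
    have hSR : S ⊆ R := hTR ▸ Set.inter_subset_right
    obtain ⟨Y, hY, rfl⟩ := exists_eq_image_add_of_mem_affinePlanes hR (hSR hs)
    refine ⟨Y, ⟨hY, fun u hu ↦ ?_⟩, rfl⟩
    obtain ⟨y, hy, hyu⟩ := hSR (hSU ▸ Set.mem_image_of_mem (fun w ↦ s + w) hu)
    rwa [← add_left_cancel hyu]

/-- After cancelling `q ^ k`, this follows from `d + 2 ≤ q ^ (d + 1)` with `d = m - k - 1`. For `k =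
0` that must be strict, and it is an equality at `q = 2`, `m = 1`. -/
lemma succ_mul_pow_lt_succ_mul_pow {q k m : ℕ} (hq : 2 ≤ q) (hk : k < m)
    (h : ¬ (q = 2 ∧ m = 1)) : (m + 1) * q ^ k < (k + 1) * q ^ m := by
  obtain ⟨d, rfl⟩ : ∃ d, m = k + (d + 1) := ⟨m - k - 1, by omega⟩
  rw [pow_add, mul_left_comm, mul_comm]
  refine Nat.mul_lt_mul_of_pos_left ?_ (pow_pos (by omega) k)
  have h1 : d + 2 ≤ q ^ (d + 1) := (Nat.lt_pow_self (n := d + 1) hq)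
  by_cases hk0 : k = 0
  · subst hk0
    have h2 : d + 2 < q ^ (d + 1) := by
      rcases Nat.eq_zero_or_pos d with rfl | hd
      · have : q ≠ 2 := fun hq2 ↦ h ⟨hq2, rfl⟩
        simp
        omega
      · have h3 : d + 1 ≤ q ^ d := Nat.lt_pow_self hq
        calc d + 2 < 2 * (d + 1) := by omega
          _ ≤ q * q ^ d := Nat.mul_le_mul hq h3
          _ = q ^ (d + 1) := by ring
    omega
  · have hk1 : 1 ≤ k := by omega
    calc k + (d + 1) + 1 < (k + 1) * (d + 2) := by nlinarith
      _ ≤ _ := by gcongr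

theorem countTendstoPoisson_affinePlanes {ι : Type*} {l : Filter ι} {n : ι → ℕ}
    {δ : ι → unitInterval} (hδ : ∀ i, 0 < δ i ∧ δ i < 1) {lam : ℝ≥0}
    (F : Type*) [Field F] [Finite F] (m : ℕ) (hqm : ¬ (Nat.card F = 2 ∧ m = 1))
    (hn : Tendsto n l atTop)
    (hexp : Tendsto (fun i ↦ expectedCount (affinePlanes F (n i) m) (Nat.card F ^ m) (δ i)) l
      (𝓝 (lam : ℝ))) :
    CountTendstoPoisson l (fun i ↦ affinePlanes F (n i) m) δ lam := by
  have hq : 2 ≤ Nat.card F := Finite.one_lt_card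
  have ha0 : Nat.card F ^ m ≠ 0 := pow_ne_zero _ (by omega)
  have hN : Tendsto (fun i ↦ (Nat.card (Fin (n i) → F) : ℝ)) l atTop := by
    refine tendsto_natCast_atTop_atTop.comp (tendsto_atTop_mono (fun i ↦ ?_) hn)
    rw [natCard_fin_fun]
    exact (Nat.lt_pow_self hq).le
  set a := Nat.card F ^ m with ha
  set D := 2 ^ m * a ^ (m + 1)
  have hD : 1 ≤ D := Nat.mul_pos (by positivity) (by positivity)
  refine countTendstoPoisson_of_ncard_inter_le _ hδ ha0
    (fun i T hT ↦ ncard_of_mem_affinePlanes hT) hexp hN ((D ^ a : ℕ) : ℝ) ?_ ?_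
  · filter_upwards [hn.eventually_ge_atTop m] with i hi
    norm_cast
    calc Nat.card (Fin (n i) → F) ≤ Nat.card (Fin (n i) → F) ^ (m + 1) :=
          Nat.le_self_pow (by omega) _
      _ ≤ D * (affinePlanes F (n i) m).ncard := pow_le_mul_ncard_affinePlanes hi
      _ ≤ _ := by
          gcongr
          exact Nat.le_self_pow ha0 _
  · filter_upwards [hn.eventually_ge_atTop m] with i hi T hT S hS hS0
    norm_cast
    rcases Set.eq_empty_or_nonempty {T' ∈ affinePlanes F (n i) m | T ∩ T' = S} with
      he | ⟨T', hT', hTT'⟩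
    · rw [he, Set.ncard_empty, zero_pow ha0, zero_mul]
      exact Nat.zero_le _
    obtain ⟨k, hk, hSk, hM⟩ := exists_ncard_inter_affinePlanes_le hT hT' hS hS0 hTT'
    have hlow := pow_le_mul_ncard_affinePlanes (F := F) hi
    have hkm := succ_mul_pow_lt_succ_mul_pow hq hk hqm
    have hNpos : 0 < Nat.card (Fin (n i) → F) := Nat.card_pos
    rw [hSk]
    have hle : Nat.card F ^ k ≤ a := Nat.pow_le_pow_right (by omega) hk.le
    -- A rearrangement of `hkm`; its strictness supplies the `+ 1`, that is, the spare factor `N`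
    -- serving as `r`.
    have hexpo : (m - k) * a + 1 ≤ (m + 1) * (a - Nat.card F ^ k) := by
      zify [hk.le, hle]
      rw [← ha] at hkm
      zify at hkm
      linarith
    set N := Nat.card (Fin (n i) → F)
    set Z := (affinePlanes F (n i) m).ncard
    calc {T' ∈ affinePlanes F (n i) m | T ∩ T' = S}.ncard ^ a * N
        ≤ (N ^ (m - k)) ^ a * N := by gcongr
      _ = N ^ ((m - k) * a + 1) := by rw [← pow_mul, pow_succ]
      _ ≤ N ^ ((m + 1) * (a - Nat.card F ^ k)) := Nat.pow_le_pow_right hNpos hexpo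
      _ = (N ^ (m + 1)) ^ (a - Nat.card F ^ k) := pow_mul _ _ _
      _ ≤ (D * Z) ^ (a - Nat.card F ^ k) := by gcongr
      _ = D ^ (a - Nat.card F ^ k) * Z ^ (a - Nat.card F ^ k) := mul_pow _ _ _
      _ ≤ D ^ a * Z ^ (a - Nat.card F ^ k) := by
          gcongr
          omega

end AffinePlanes

theorem theorem2 {ι : Type*} (l : Filter ι) (n : ι → ℕ) (δ : ι → unitInterval)
    (hδ : ∀ i, 0 < δ i ∧ δ i < 1) (lam : ℝ≥0) (hlam : 0 < lam) :
    -- three-term arithmetic progressions, as `q + n → ∞`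
    (∀ (F : ι → Type*) [∀ i, Field (F i)] [∀ i, Finite (F i)],
      Tendsto (fun i ↦ Nat.card (F i) + n i) l atTop →
      Tendsto (fun i ↦ expectedCount (threeAPs (F i) (n i)) 3 (δ i)) l (𝓝 (lam : ℝ)) →
      CountTendstoPoisson l (fun i ↦ threeAPs (F i) (n i)) δ lam) ∧
    -- parallelograms, as `q + n → ∞`
    (∀ (F : ι → Type*) [∀ i, Field (F i)] [∀ i, Finite (F i)],
      Tendsto (fun i ↦ Nat.card (F i) + n i) l atTop →
      Tendsto (fun i ↦ expectedCount (parallelograms (F i) (n i)) 4 (δ i)) l (𝓝 (lam : ℝ)) →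
      CountTendstoPoisson l (fun i ↦ parallelograms (F i) (n i)) δ lam) ∧
    -- right triangles, as `q → ∞`, with `n ≥ 2` bounded or growing
    (∀ (F : ι → Type*) [∀ i, Field (F i)] [∀ i, Finite (F i)],
      (∀ i, 2 ≤ n i) →
      Tendsto (fun i ↦ Nat.card (F i)) l atTop →
      Tendsto (fun i ↦ expectedCount (rightTriangles (F i) (n i)) 3 (δ i)) l (𝓝 (lam : ℝ)) →
      CountTendstoPoisson l (fun i ↦ rightTriangles (F i) (n i)) δ lam) ∧
    -- `m`-dimensional planes, as `n → ∞`, with `q` and `m` fixed and `(q, m) ≠ (2, 1)`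
    (∀ (F : Type*) [Field F] [Finite F] (m : ℕ),
      1 ≤ m → ¬ (Nat.card F = 2 ∧ m = 1) →
      Tendsto n l atTop →
      Tendsto (fun i ↦ expectedCount (affinePlanes F (n i) m) (Nat.card F ^ m) (δ i)) l
        (𝓝 (lam : ℝ)) →
      CountTendstoPoisson l (fun i ↦ affinePlanes F (n i) m) δ lam) := by
  exact ⟨fun F _ _ ↦ countTendstoPoisson_threeAPs hδ hlam F,
    fun F _ _ ↦ countTendstoPoisson_parallelograms hδ hlam F,
    fun F _ _ ↦ countTendstoPoisson_rightTriangles hδ F,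
    fun F _ _ m _ hqm ↦ countTendstoPoisson_affinePlanes hδ F m hqm⟩
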